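/- Let $\mathbb S^3$ be the unit sphere with its distance of constant curvature $1$, and let $T$ be a nondegenerate tetrahedron in $\mathbb S^3$ with vertices $A_1,A_2,A_3,A_4$ (unit vectors that are linearly independent in $\mathbb R^4$); its faces are the four spherical triangles spanned by three of the vertices, and its surface is the union of the faces. A simple geodesic loop at $A_i$ is a simple closed curve on the surface of $T$ which passes through $A_i$ and through no other vertex, and which is a geodesic except at $A_i$, that is, every other point of the curve has a neighbourhood in the curve such that each segment of the curve in it realizes the intrinsic distance on the surface between its end points. Suppose that every angle of every face of $T$ exceeds $\pi/2$ and that every edge of $T$ has length exceeding $\pi/2$. Then for each vertex $A_i$ there exist $3$ distinct simple geodesic loops through $A_i$, one for each of the other vertices $A_j$. They are described as follows. Cut the surface along the three edges at $A_i$ and unfold it on $\mathbb S^2$: the face opposite to $A_i$ is developed isometrically on a triangle with vertices $B_m$ ($m\neq i$, $B_m$ being the developed vertex $A_m$), and for each $m \ne i$ the face opposite to $A_m$ is developed isometrically on the outer side of the edge it shares with that triangle; let $C_m$ be the copy of $A_i$ in it. For $j\neq i$ let $k,l$ be the two remaining indices. There is a point $O\in\mathbb S^2$ with $\angle OB_jC_k=\angle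 OB_jC_l$, $|OC_k|=|OC_l|=\pi/2$, $|OB_j|<\pi/2$, $|OB_k|>\pi/2$, $|OB_l|>\pi/2$, and the loop belonging to $j$ develops onto a simple arc from $C_k$ to $C_l$ of the circle of radius $\pi/2$ about $O$ (a great circle), running successively in the developed faces opposite to $A_k$, to $A_i$ and to $A_l$. -/

import Mathlib

open Set

/-- The unit sphere `S^n` in `ℝ^(n+1)`. -/
@[ext]
structure Sph (n : ℕ) where
  vec : EuclideanSpace ℝ (Fin (n + 1))
  norm_vec : ‖vec‖ = 1

/-- `S^n` with its standard (curvature one) distance: the angle between unit vectors. -/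
noncomputable instance Sph.instMetricSpace (n : ℕ) : MetricSpace (Sph n) where
  dist x y := InnerProductGeometry.angle x.vec y.vec
  dist_self x := InnerProductGeometry.angle_self (fun h => by
    have hx := x.norm_vec
    rw [h, norm_zero] at hx
    exact zero_ne_one hx)
  dist_comm x y := InnerProductGeometry.angle_comm _ _
  dist_triangle x y z := InnerProductGeometry.angle_le_angle_add_angle _ _ _
  eq_of_dist_eq_zero := by
    intro x y h
    have h1 : inner ℝ x.vec y.vec = (1 : ℝ) := by
      have h2 := InnerProductGeometry.cos_angle_mul_norm_mul_norm x.vec y.vec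
      rw [show InnerProductGeometry.angle x.vec y.vec = 0 from h, Real.cos_zero,
        x.norm_vec, y.norm_vec] at h2
      linarith
    exact Sph.ext ((inner_eq_one_iff_of_norm_eq_one x.norm_vec y.norm_vec).1 h1)

/-- The spherical angle at `b` between the great-circle arcs from `b` to `a` and from `b` to `c`:
the angle between their initial tangent vectors at `b`. -/
noncomputable def sphAngle {n : ℕ} (a b c : Sph n) : ℝ :=
  InnerProductGeometry.angle
    (a.vec - inner ℝ a.vec b.vec • b.vec) (c.vec - inner ℝ c.vec b.vec • b.vec)

/-- `A 0, …, A 3` are the vertices of a (nondegenerate) tetrahedron in `S^3`. -/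
def IsTetrahedron (A : Fin 4 → Sph 3) : Prop :=
  LinearIndependent ℝ (fun m => (A m).vec)

/-- The face opposite to the vertex `A k`: the spherical triangle spanned by the other three
vertices. -/
def face (A : Fin 4 → Sph 3) (k : Fin 4) : Set (Sph 3) :=
  {x | ∃ w : Fin 4 → ℝ, (∀ m, 0 ≤ w m) ∧ w k = 0 ∧ x.vec = ∑ m, w m • (A m).vec}

/-- The surface of the tetrahedron: the union of its four faces. -/
def surface (A : Fin 4 → Sph 3) : Set (Sph 3) :=
  ⋃ k, face A k

/-- The intrinsic distance on `M`: the infimum of the lengths of the curves in `M` from `p`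
to `q`. -/
noncomputable def intrinsicEDist {X : Type*} [MetricSpace X] (M : Set X) (p q : X) : ENNReal :=
  ⨅ (c : ℝ → X) (_ : ContinuousOn c (Icc 0 1) ∧ MapsTo c (Icc 0 1) M ∧ c 0 = p ∧ c 1 = q),
    eVariationOn c (Icc 0 1)

/-- `γ`, restricted to the parameter interval `J`, is a geodesic of `M`: every parameter has a
neighbourhood in `J` on which each segment of `γ` realizes the intrinsic distance between its
end points. -/
def IsGeodesicOn {X : Type*} [MetricSpace X] (M : Set X) (γ : ℝ → X) (J : Set ℝ) : Prop :=
  ContinuousOn γ J ∧ MapsTo γ J M ∧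
    ∀ t ∈ J, ∃ ε > 0, ∀ s ∈ J ∩ Ioo (t - ε) (t + ε), ∀ u ∈ J ∩ Ioo (t - ε) (t + ε), s ≤ u →
      eVariationOn γ (Icc s u) = intrinsicEDist M (γ s) (γ u)

/-- `γ : [0,1] → S^3` is a simple geodesic loop at the vertex `A i`: a simple closed curve on the
surface that contains `A i` and no other vertex, and is a geodesic except at `A i`. -/
structure IsSimpleGeodesicLoop (A : Fin 4 → Sph 3) (i : Fin 4) (γ : ℝ → Sph 3) : Prop where
  continuousOn : ContinuousOn γ (Icc 0 1)
  mapsTo : MapsTo γ (Icc 0 1) (surface A)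
  start : γ 0 = A i
  finish : γ 1 = A i
  simple : InjOn γ (Ico 0 1)
  avoids : ∀ t ∈ Icc (0 : ℝ) 1, ∀ m, m ≠ i → γ t ≠ A m
  geodesic : IsGeodesicOn (surface A) γ (Ioo 0 1)

/-- `x` and `y` lie strictly on opposite sides of a great circle of `S^2` through `a` and `b`. -/
def OppositeSides (a b x y : Sph 2) : Prop :=
  ∃ ν : EuclideanSpace ℝ (Fin 3), inner ℝ ν a.vec = (0 : ℝ) ∧ inner ℝ ν b.vec = (0 : ℝ) ∧
    inner ℝ ν x.vec < (0 : ℝ) ∧ (0 : ℝ) < inner ℝ ν y.vec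

/-- The unfolding of the surface of the tetrahedron on `S^2` obtained by cutting along the three
edges at `A i`. For `m ≠ i`, `B m` is the developed vertex `A m` of the face opposite to `A i`, and
`C m` is the developed copy of `A i` in the face opposite to `A m`; each of these three faces is
developed isometrically, on the outer side of the edge it shares with the face opposite to `A i`.
(The values `B i` and `C i` play no role.) -/
structure IsUnfolding (A : Fin 4 → Sph 3) (i : Fin 4) (B C : Fin 4 → Sph 2) : Prop where
  base : ∀ m n, m ≠ i → n ≠ i → dist (B m) (B n) = dist (A m) (A n)
  flap : ∀ m n, m ≠ i → n ≠ i → n ≠ m → dist (C m) (B n) = dist (A i) (A n)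
  outer : ∀ m n p, [i, m, n, p].Nodup → OppositeSides (B n) (B p) (B m) (C m)

/-- In the unfolding `B, C` the curve `γ` at `A i` becomes the curve `σ : [0,1] → S^2` from `C k` to
`C l`: it runs first in the face opposite to `A k`, then in the face opposite to `A i`, then in
the face opposite to `A l`, and at every time `σ` is the developed position of `γ` in the respective
face, i.e. the point with the same distances to the three vertices of the face. -/
def DevelopsTo (A : Fin 4 → Sph 3) (i k l : Fin 4) (B C : Fin 4 → Sph 2)
    (γ : ℝ → Sph 3) (σ : ℝ → Sph 2) : Prop :=
  σ 0 = C k ∧ σ 1 = C l ∧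
  ∃ t₁ t₂ : ℝ, 0 < t₁ ∧ t₁ < t₂ ∧ t₂ < 1 ∧
    (∀ t ∈ Icc 0 t₁, γ t ∈ face A k ∧ dist (σ t) (C k) = dist (γ t) (A i) ∧
      ∀ m, m ≠ i → m ≠ k → dist (σ t) (B m) = dist (γ t) (A m)) ∧
    (∀ t ∈ Icc t₁ t₂, γ t ∈ face A i ∧
      ∀ m, m ≠ i → dist (σ t) (B m) = dist (γ t) (A m)) ∧
    (∀ t ∈ Icc t₂ 1, γ t ∈ face A l ∧ dist (σ t) (C l) = dist (γ t) (A i) ∧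
      ∀ m, m ≠ i → m ≠ l → dist (σ t) (B m) = dist (γ t) (A m))

/-- `σ : [0,1] → S^2` is a simple arc of the circle of radius `π / 2` about `O`, which is a great
circle. -/
def IsGreatCircleArcAbout (O : Sph 2) (σ : ℝ → Sph 2) : Prop :=
  ContinuousOn σ (Icc 0 1) ∧ InjOn σ (Icc 0 1) ∧ ∀ t ∈ Icc (0 : ℝ) 1, dist O (σ t) = Real.pi / 2

/-! Look at the unfolding around `B j`. The three face angles at `A j` exceed π/2, and their sum is
below 2π (`IsTetrahedron.sphAngle_add_add_lt`). So the developed faces leave a gap of angle 2h > 0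
between the arcs from `B j` to `C k` and to `C l`, which have a common length d > π/2. In polar
coordinates about `B j`, measured from the bisector e of the gap, the edges to `B l` and `B k` lie
at obtuse angles on either side (`Ortho3.exists_frame`).

By symmetry the great circle through `C k` and `C l` has its pole O in the plane of b = `B j` and e.
As d > π/2, its long arc, of length 2τ with π/2 < τ < π, has a midpoint E on the side away from the
gap, closer to `B j` than π/2. Because the polar angles are obtuse, the arc meets the directions of
both edges within a quarter turn of E. The meeting points are closer to `B j` than π/2, hence
interior to the edges, which are longer (`Ortho3.exists_crossing`, `Ortho3.exists_arc`). The
crossings cut the arc into three pieces shorter than π, each with both end points in one developed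
face, so each piece stays in that face (`exists_arc_weights`).

Each piece is folded back by a linear isometry (`FoldedArc`). The loop is a geodesic inside a face
because the distance of the ambient sphere already bounds curves from below. Near a crossing, a
competing curve either reaches a face that is not near, or crosses the common edge and is bounded by
the triangle inequality in the unfolding (`IsTetrahedron.dist_le_intrinsicEDist_of_adjacent`).
Barycentric weights give simplicity. Loops for different j are distinct: the loop of j is covered by
the faces other than the one opposite to `A j`, whereas the others enter the relative interior of
that face. -/

/-! ### Distances, tangent vectors and angles on the sphere. -/

theorem Sph.cos_dist {n : ℕ} (x y : Sph n) : Real.cos (dist x y) = inner ℝ x.vec y.vec :=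
  (InnerProductGeometry.inner_eq_cos_angle_of_norm_eq_one x.norm_vec y.norm_vec).symm

theorem Sph.dist_le_pi {n : ℕ} (x y : Sph n) : dist x y ≤ Real.pi :=
  InnerProductGeometry.angle_le_pi _ _

theorem Sph.inner_self {n : ℕ} (x : Sph n) : inner ℝ x.vec x.vec = (1 : ℝ) :=
  inner_self_eq_one_of_norm_eq_one x.norm_vec

theorem Sph.dist_eq_iff {n m : ℕ} (x y : Sph n) (z w : Sph m) :
    dist x y = dist z w ↔ inner ℝ x.vec y.vec = (inner ℝ z.vec w.vec : ℝ) := by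
  rw [← Sph.cos_dist, ← Sph.cos_dist]
  exact ⟨fun h => by rw [h], fun h => Real.injOn_cos ⟨dist_nonneg, Sph.dist_le_pi _ _⟩
    ⟨dist_nonneg, Sph.dist_le_pi _ _⟩ h⟩

theorem Sph.sin_dist_nonneg {n : ℕ} (x y : Sph n) : 0 ≤ Real.sin (dist x y) :=
  Real.sin_nonneg_of_nonneg_of_le_pi dist_nonneg (Sph.dist_le_pi _ _)

theorem Sph.dist_lt_pi_div_two_iff {n : ℕ} (x y : Sph n) :
    dist x y < Real.pi / 2 ↔ 0 < (inner ℝ x.vec y.vec : ℝ) := by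
  rw [← Sph.cos_dist]
  refine ⟨fun h => Real.cos_pos_of_mem_Ioo ⟨?_, h⟩, fun h => ?_⟩
  · linarith [Real.pi_pos, dist_nonneg (x := x) (y := y)]
  · by_contra! h0
    exact h.not_ge (Real.cos_nonpos_of_pi_div_two_le_of_le h0
      (by linarith [Real.pi_pos, Sph.dist_le_pi x y]))

theorem Sph.pi_div_two_lt_dist_iff {n : ℕ} (x y : Sph n) :
    Real.pi / 2 < dist x y ↔ (inner ℝ x.vec y.vec : ℝ) < 0 := by
  rw [← Sph.cos_dist]
  refine ⟨fun h => Real.cos_neg_of_pi_div_two_lt_of_lt h ?_, fun h => ?_⟩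
  · linarith [Real.pi_pos, Sph.dist_le_pi x y]
  · by_contra! h0
    exact h.not_ge (Real.cos_nonneg_of_mem_Icc
      ⟨by linarith [Real.pi_pos, dist_nonneg (x := x) (y := y)], h0⟩)

theorem Sph.dist_eq_pi_div_two_iff {n : ℕ} (x y : Sph n) :
    dist x y = Real.pi / 2 ↔ (inner ℝ x.vec y.vec : ℝ) = 0 :=
  (InnerProductGeometry.inner_eq_zero_iff_angle_eq_pi_div_two _ _).symm

/-- The component of `a` tangent to the sphere at `b`. -/
noncomputable def Sph.tangent {n : ℕ} (b a : Sph n) : EuclideanSpace ℝ (Fin (n + 1)) :=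
  a.vec - inner ℝ a.vec b.vec • b.vec

theorem Sph.inner_tangent {n : ℕ} (b x y : Sph n) :
    inner ℝ (b.tangent x) (b.tangent y) =
      (inner ℝ x.vec y.vec - inner ℝ x.vec b.vec * inner ℝ y.vec b.vec : ℝ) := by
  simp only [Sph.tangent, inner_sub_left, inner_sub_right, real_inner_smul_left,
    real_inner_smul_right, Sph.inner_self, real_inner_comm b.vec]
  ring

theorem Sph.norm_tangent {n : ℕ} (b x : Sph n) : ‖b.tangent x‖ = Real.sin (dist x b) := by
  have h : ‖b.tangent x‖ ^ 2 = Real.sin (dist x b) ^ 2 := by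
    rw [← real_inner_self_eq_norm_sq, Sph.inner_tangent, Real.sin_sq, Sph.cos_dist, Sph.inner_self]
    ring
  exact (sq_eq_sq₀ (norm_nonneg _) (Sph.sin_dist_nonneg _ _)).1 h

/-- The spherical law of cosines. -/
theorem Sph.law_of_cosines {n : ℕ} (x b y : Sph n) :
    inner ℝ x.vec y.vec = Real.cos (dist x b) * Real.cos (dist y b) +
      Real.sin (dist x b) * Real.sin (dist y b) * Real.cos (sphAngle x b y) := by
  have h := InnerProductGeometry.cos_angle_mul_norm_mul_norm (b.tangent x) (b.tangent y)
  rw [Sph.inner_tangent, Sph.norm_tangent, Sph.norm_tangent] at h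
  rw [Sph.cos_dist, Sph.cos_dist]
  change Real.cos (sphAngle x b y) * _ = _ at h
  linarith

/-! ### Angle sums of trihedral angles. -/

/-- Three vectors are linearly independent, in terms of coefficients. -/
def Indep3 {V : Type*} [AddCommGroup V] [Module ℝ V] (x y z : V) : Prop :=
  ∀ r s t : ℝ, r • x + s • y + t • z = 0 → r = 0 ∧ s = 0 ∧ t = 0

theorem Indep3.tangent {n : ℕ} {b x y z : Sph n}
    (h : ∀ q r s t : ℝ, q • b.vec + r • x.vec + s • y.vec + t • z.vec = 0 →
      q = 0 ∧ r = 0 ∧ s = 0 ∧ t = 0) :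
    Indep3 (b.tangent x) (b.tangent y) (b.tangent z) := by
  intro r s t h0
  refine (h (-(r * inner ℝ x.vec b.vec + s * inner ℝ y.vec b.vec + t * inner ℝ z.vec b.vec))
    r s t ?_).2
  rw [← h0]
  simp only [Sph.tangent]
  module

theorem InnerProductGeometry.angle_lt_pi_of_coeff {V : Type*} [NormedAddCommGroup V]
    [InnerProductSpace ℝ V] {x y : V} (h : ∀ r s : ℝ, r • x + s • y = 0 → r = 0 ∧ s = 0) :
    angle x y < Real.pi := by
  refine lt_of_le_of_ne (angle_le_pi _ _) fun h0 => ?_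
  obtain ⟨-, r, -, rfl⟩ := angle_eq_pi_iff.1 h0
  have := h r (-1) (by module)
  linarith [this.2]

/-- Replacing y by -y turns its two angles into their supplements, so the bound is the triangle
inequality for x, -y, z. Equality there would force x and z to be opposite, or -y to lie in the cone
they span; independence excludes both. -/
theorem Indep3.angle_add_add_lt {V : Type*} [NormedAddCommGroup V]
    [InnerProductSpace ℝ V] {x y z : V} (h : Indep3 x y z) :
    InnerProductGeometry.angle x y + InnerProductGeometry.angle y z +
      InnerProductGeometry.angle z x < 2 * Real.pi := by
  have h1 := InnerProductGeometry.angle_le_angle_add_angle x (-y) z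
  have h2 : InnerProductGeometry.angle x z ≠
      InnerProductGeometry.angle x (-y) + InnerProductGeometry.angle (-y) z := by
    have hy : -y ≠ 0 := by
      intro hy
      have := h 0 1 0 (by simp [neg_eq_zero.1 hy])
      exact one_ne_zero this.2.1
    rw [Ne, InnerProductGeometry.angle_eq_angle_add_angle_iff hy]
    rintro (h3 | h3)
    · refine (InnerProductGeometry.angle_lt_pi_of_coeff fun r s hrs => ?_).ne h3
      have := h r 0 s (by rw [← hrs]; module)
      exact ⟨this.1, this.2.2⟩
    · obtain ⟨r, s, hrs⟩ := Submodule.mem_span_pair.1 h3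
      rw [NNReal.smul_def, NNReal.smul_def] at hrs
      have := h r 1 s (by rw [add_right_comm, hrs]; module)
      exact one_ne_zero this.2.1
  have h3 := lt_of_le_of_ne h1 h2
  rw [InnerProductGeometry.angle_neg_right, InnerProductGeometry.angle_neg_left,
    InnerProductGeometry.angle_comm x z] at h3
  linarith

theorem sphAngle_comm {n : ℕ} (x b y : Sph n) : sphAngle x b y = sphAngle y b x :=
  InnerProductGeometry.angle_comm _ _

/-! ### Indices, barycentric weights and face angles of a tetrahedron. -/

theorem Fin4.univ_eq {i j k l : Fin 4} (h : [i, j, k, l].Nodup) :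
    (Finset.univ : Finset (Fin 4)) = {i, j, k, l} := by
  revert i j k l; decide

theorem Fin4.sum_eq {V : Type*} [AddCommMonoid V] {i j k l : Fin 4} (h : [i, j, k, l].Nodup)
    (f : Fin 4 → V) : ∑ m, f m = f i + f j + f k + f l := by
  rw [Fin4.univ_eq h]
  simp only [List.nodup_cons, List.mem_cons, List.not_mem_nil, or_false, not_or] at h
  rw [Finset.sum_insert (by simp; tauto), Finset.sum_insert (by simp; tauto),
    Finset.sum_insert (by simp; tauto), Finset.sum_singleton]
  simp only [add_assoc]

theorem Fin4.exists_eq {i j k l : Fin 4} (h : [i, j, k, l].Nodup)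
    (a b c d : ℝ) : ∃ w : Fin 4 → ℝ, w i = a ∧ w j = b ∧ w k = c ∧ w l = d := by
  simp only [List.nodup_cons, List.mem_cons, List.not_mem_nil, or_false, not_or] at h
  refine ⟨fun m => if m = i then a else if m = j then b else if m = k then c else d, ?_⟩
  obtain ⟨⟨h1, h2, h3⟩, ⟨h4, h5⟩, h6, -⟩ := h
  simp [Ne.symm h1, Ne.symm h2, Ne.symm h3, Ne.symm h4, Ne.symm h5, Ne.symm h6]

theorem Fin4.cases {i j k l : Fin 4} (h : [i, j, k, l].Nodup) (m : Fin 4) :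
    m = i ∨ m = j ∨ m = k ∨ m = l := by
  revert i j k l m; decide

theorem IsTetrahedron.coeff {A : Fin 4 → Sph 3} (hA : IsTetrahedron A) {i j k l : Fin 4}
    (h : [i, j, k, l].Nodup) (q r s t : ℝ)
    (h0 : q • (A i).vec + r • (A j).vec + s • (A k).vec + t • (A l).vec = 0) :
    q = 0 ∧ r = 0 ∧ s = 0 ∧ t = 0 := by
  obtain ⟨w, rfl, rfl, rfl, rfl⟩ := Fin4.exists_eq h q r s t
  have := Fintype.linearIndependent_iff.1 hA w (by rw [Fin4.sum_eq h, h0])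
  exact ⟨this _, this _, this _, this _⟩

theorem IsTetrahedron.weights_unique {A : Fin 4 → Sph 3} (hA : IsTetrahedron A)
    {v w : Fin 4 → ℝ} (h : ∑ m, v m • (A m).vec = ∑ m, w m • (A m).vec) : v = w := by
  funext m
  have := Fintype.linearIndependent_iff.1 hA (v - w) (by
    simp only [Pi.sub_apply, sub_smul, Finset.sum_sub_distrib, h, sub_self]) m
  simpa [sub_eq_zero] using this

theorem IsTetrahedron.dist_lt_pi {A : Fin 4 → Sph 3} (hA : IsTetrahedron A) {i j : Fin 4}
    (h : i ≠ j) : dist (A i) (A j) < Real.pi := by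
  obtain ⟨k, l, hn⟩ : ∃ k l, [i, j, k, l].Nodup := by revert i j; decide
  refine InnerProductGeometry.angle_lt_pi_of_coeff fun r s hrs => ?_
  have := hA.coeff hn r s 0 0 (by rw [← hrs]; module)
  exact ⟨this.1, this.2.1⟩

theorem IsTetrahedron.sphAngle_lt_pi {A : Fin 4 → Sph 3} (hA : IsTetrahedron A) {i j k l : Fin 4}
    (hn : [i, j, k, l].Nodup) : sphAngle (A i) (A j) (A k) < Real.pi := by
  refine InnerProductGeometry.angle_lt_pi_of_coeff fun r s hrs => ?_
  have := hA.coeff hn r (-(r * inner ℝ (A i).vec (A j).vec + s * inner ℝ (A k).vec (A j).vec)) s 0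
    (by rw [← hrs]; module)
  exact ⟨this.1, this.2.2.1⟩

/-- The tangent vectors at `A j` towards the other vertices are independent. The strict inequality
is what opens a gap in the unfolding around `B j`. -/
theorem IsTetrahedron.sphAngle_add_add_lt {A : Fin 4 → Sph 3} (hA : IsTetrahedron A)
    {i j k l : Fin 4} (hn : [i, j, k, l].Nodup) :
    sphAngle (A i) (A j) (A l) + sphAngle (A l) (A j) (A k) + sphAngle (A k) (A j) (A i) <
      2 * Real.pi := by
  refine Indep3.angle_add_add_lt (Indep3.tangent fun q r s t h => ?_)
  have := hA.coeff hn r q t s (by rw [← h]; module)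
  tauto

/-! ### Polar coordinates around a vertex of the unfolding. -/

/-- An orthonormal triple of vectors. -/
structure Ortho3 {V : Type*} [NormedAddCommGroup V] [InnerProductSpace ℝ V] (b e f : V) : Prop where
  bb : inner ℝ b b = (1 : ℝ)
  ee : inner ℝ e e = (1 : ℝ)
  ff : inner ℝ f f = (1 : ℝ)
  be : inner ℝ b e = (0 : ℝ)
  bf : inner ℝ b f = (0 : ℝ)
  ef : inner ℝ e f = (0 : ℝ)

namespace Ortho3

variable {V : Type*} [NormedAddCommGroup V] [InnerProductSpace ℝ V] {b e f : V}

theorem inner_eq (h : Ortho3 b e f) (x y z x' y' z' : ℝ) :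
    inner ℝ (x • b + y • e + z • f) (x' • b + y' • e + z' • f) =
      (x * x' + y * y' + z * z' : ℝ) := by
  simp only [inner_add_left, inner_add_right, real_inner_smul_left, real_inner_smul_right, h.bb,
    h.ee, h.ff, h.be, h.bf, h.ef, real_inner_comm b e, real_inner_comm b f, real_inner_comm e f]
  ring

theorem of_inner_eq (h : Ortho3 b e f) {b' e' f' : V} (x y z x' y' z' x'' y'' z'' : ℝ)
    (hb : b' = x • b + y • e + z • f) (he : e' = x' • b + y' • e + z' • f)
    (hf : f' = x'' • b + y'' • e + z'' • f)
    (h1 : x * x + y * y + z * z = 1) (h2 : x' * x' + y' * y' + z' * z' = 1)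
    (h3 : x'' * x'' + y'' * y'' + z'' * z'' = 1) (h4 : x * x' + y * y' + z * z' = 0)
    (h5 : x * x'' + y * y'' + z * z'' = 0) (h6 : x' * x'' + y' * y'' + z' * z'' = 0) :
    Ortho3 b' e' f' := by
  subst hb he hf
  constructor <;> rw [h.inner_eq] <;> assumption

theorem expand {b e f : EuclideanSpace ℝ (Fin 3)} (h : Ortho3 b e f)
    (v : EuclideanSpace ℝ (Fin 3)) :
    v = (inner ℝ b v : ℝ) • b + (inner ℝ e v : ℝ) • e + (inner ℝ f v : ℝ) • f := by
  have ho : Orthonormal ℝ ![b, e, f] := by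
    rw [orthonormal_iff_ite]
    have h1 := real_inner_comm b e
    have h2 := real_inner_comm b f
    have h3 := real_inner_comm e f
    rw [h.be] at h1
    rw [h.bf] at h2
    rw [h.ef] at h3
    intro i j
    fin_cases i <;> fin_cases j
    exacts [h.bb, h.be, h.bf, h1, h.ee, h.ef, h2, h3, h.ff]
  let B := (basisOfOrthonormalOfCardEqFinrank ho (by simp)).toOrthonormalBasis (by simpa using ho)
  have hB := B.sum_repr' v
  simpa [B, Fin.sum_univ_three] using hB.symm

/-- The position of the apex of a triangle lying on the other side of its base `b, b'` than `x`. -/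
theorem flap_eq {b p q : EuclideanSpace ℝ (Fin 3)} (h : Ortho3 b p q)
    {y x c ν : EuclideanSpace ℝ (Fin 3)}
    {s d a x₀ x₁ x₂ : ℝ} (hy : y = Real.cos s • b + Real.sin s • p) (hs : 0 < Real.sin s)
    (hx : x = x₀ • b + x₁ • p + x₂ • q) (hx₂ : 0 < x₂) (hd : 0 < Real.sin d) (ha : 0 < Real.sin a)
    (hcb : inner ℝ c b = Real.cos d)
    (hcy : inner ℝ c y = Real.cos d * Real.cos s + Real.sin d * Real.sin s * Real.cos a)
    (hc : inner ℝ c c = (1 : ℝ)) (hνb : inner ℝ ν b = (0 : ℝ)) (hνy : inner ℝ ν y = (0 : ℝ))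
    (hνx : inner ℝ ν x < (0 : ℝ)) (hνc : (0 : ℝ) < inner ℝ ν c) :
    c = Real.cos d • b + Real.sin d • (Real.cos a • p - Real.sin a • q) := by
  obtain ⟨c₀, c₁, c₂, rfl⟩ : ∃ c₀ c₁ c₂ : ℝ, c = c₀ • b + c₁ • p + c₂ • q := ⟨_, _, _, h.expand c⟩
  obtain ⟨n₀, n₁, n₂, rfl⟩ : ∃ c₀ c₁ c₂ : ℝ, ν = c₀ • b + c₁ • p + c₂ • q := ⟨_, _, _, h.expand ν⟩
  subst hx
  have hb' : b = (1 : ℝ) • b + (0 : ℝ) • p + (0 : ℝ) • q := by module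
  have hy' : y = Real.cos s • b + Real.sin s • p + (0 : ℝ) • q := by rw [hy]; module
  rw [h.inner_eq] at hc hνc hνx
  rw [hy', h.inner_eq] at hcy hνy
  have e1 := h.inner_eq c₀ c₁ c₂ 1 0 0
  have e2 := h.inner_eq n₀ n₁ n₂ 1 0 0
  rw [← hb'] at e1 e2
  rw [e1] at hcb
  rw [e2] at hνb
  have h0 : c₀ = Real.cos d := by linarith
  have h1 : c₁ = Real.sin d * Real.cos a := by
    have : Real.sin s * c₁ = Real.sin s * (Real.sin d * Real.cos a) := by rw [h0] at hcy; linarith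
    exact mul_left_cancel₀ hs.ne' this
  have hn0 : n₀ = 0 := by linarith
  have hn1 : n₁ = 0 := by
    rw [hn0] at hνy
    have : Real.sin s * n₁ = 0 := by linarith
    exact (mul_eq_zero.1 this).resolve_left hs.ne'
  rw [hn0, hn1] at hνx hνc
  have hn2 : n₂ < 0 := by
    by_contra! hn
    nlinarith [mul_nonneg hn hx₂.le]
  have hc2 : c₂ < 0 := by
    by_contra! hn
    nlinarith [mul_nonneg hn (neg_nonneg.2 hn2.le)]
  have h2 : c₂ = -(Real.sin d * Real.sin a) := by
    have hsq : (-c₂) ^ 2 = (Real.sin d * Real.sin a) ^ 2 := by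
      rw [h0, h1] at hc
      linear_combination hc - Real.sin_sq_add_cos_sq d -
        Real.sin d ^ 2 * Real.sin_sq_add_cos_sq a
    have := (sq_eq_sq₀ (by linarith) (mul_pos hd ha).le).1 hsq
    linarith
  rw [h0, h1, h2]
  module

/-- Polar coordinates about `b` for the unfolding of the three faces at the vertex `b`, measured
from the bisector of the gap. -/
theorem exists_frame {b y x c c' : EuclideanSpace ℝ (Fin 3)} {d s t a β a' : ℝ}
    (hb : inner ℝ b b = (1 : ℝ)) (hy : inner ℝ y y = (1 : ℝ)) (hx : inner ℝ x x = (1 : ℝ))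
    (hc : inner ℝ c c = (1 : ℝ)) (hc' : inner ℝ c' c' = (1 : ℝ))
    (hd : 0 < Real.sin d) (hs : 0 < Real.sin s) (ht : 0 < Real.sin t)
    (ha : 0 < Real.sin a) (hβ : 0 < Real.sin β) (ha' : 0 < Real.sin a')
    (hyb : inner ℝ y b = Real.cos s) (hxb : inner ℝ x b = Real.cos t)
    (hcb : inner ℝ c b = Real.cos d) (hcb' : inner ℝ c' b = Real.cos d)
    (hyx : inner ℝ y x = Real.cos s * Real.cos t + Real.sin s * Real.sin t * Real.cos β)
    (hcy : inner ℝ c y = Real.cos d * Real.cos s + Real.sin d * Real.sin s * Real.cos a)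
    (hcx : inner ℝ c' x = Real.cos d * Real.cos t + Real.sin d * Real.sin t * Real.cos a')
    {ν ν' : EuclideanSpace ℝ (Fin 3)}
    (hνb : inner ℝ ν b = (0 : ℝ)) (hνy : inner ℝ ν y = (0 : ℝ))
    (hνx : inner ℝ ν x < (0 : ℝ)) (hνc : (0 : ℝ) < inner ℝ ν c)
    (hνb' : inner ℝ ν' b = (0 : ℝ)) (hνx' : inner ℝ ν' x = (0 : ℝ))
    (hνy' : inner ℝ ν' y < (0 : ℝ)) (hνc' : (0 : ℝ) < inner ℝ ν' c')
    {h : ℝ} (hh : 2 * h + a + β + a' = 2 * Real.pi) :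
    ∃ e f, Ortho3 b e f ∧
      c = Real.cos d • b + Real.sin d • (Real.cos h • e + Real.sin h • f) ∧
      c' = Real.cos d • b + Real.sin d • (Real.cos h • e - Real.sin h • f) ∧
      y = Real.cos s • b + Real.sin s • (Real.cos (h + a) • e + Real.sin (h + a) • f) ∧
      x = Real.cos t • b + Real.sin t • (Real.cos (h + a') • e - Real.sin (h + a') • f) := by
  obtain ⟨p, hp⟩ : ∃ p, p = (Real.sin s)⁻¹ • (y - Real.cos s • b) := ⟨_, rfl⟩
  have hyp : y = Real.cos s • b + Real.sin s • p := by
    rw [hp, smul_smul, mul_inv_cancel₀ hs.ne']; module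
  have hpb : inner ℝ b p = (0 : ℝ) := by
    rw [hp, real_inner_smul_right, inner_sub_right, real_inner_smul_right, hb, real_inner_comm, hyb]
    ring
  have hpp : inner ℝ p p = (1 : ℝ) := by
    have h1 := hy
    rw [hyp] at h1
    simp only [inner_add_left, inner_add_right, real_inner_smul_left, real_inner_smul_right, hb,
      hpb, real_inner_comm b p] at h1
    have : Real.sin s ^ 2 * inner ℝ p p = Real.sin s ^ 2 * 1 := by
      linear_combination h1 - Real.sin_sq_add_cos_sq s
    exact mul_left_cancel₀ (pow_ne_zero 2 hs.ne') this
  have hpx : inner ℝ p x = Real.sin t * Real.cos β := by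
    rw [hp, real_inner_smul_left, inner_sub_left, real_inner_smul_left, real_inner_comm x b, hxb,
      hyx]
    field_simp
    ring
  have hne : Real.sin t * Real.sin β ≠ 0 := (mul_pos ht hβ).ne'
  obtain ⟨q, hq⟩ : ∃ q, q = (Real.sin t * Real.sin β)⁻¹ •
    (x - Real.cos t • b - (Real.sin t * Real.cos β) • p) := ⟨_, rfl⟩
  have hxq : x = Real.cos t • b + (Real.sin t * Real.cos β) • p +
      (Real.sin t * Real.sin β) • q := by
    rw [hq, smul_smul, mul_inv_cancel₀ hne]; module
  have hbq : inner ℝ b q = (0 : ℝ) := by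
    rw [hq, real_inner_smul_right, inner_sub_right, inner_sub_right, real_inner_smul_right,
      real_inner_smul_right, hb, hpb, real_inner_comm, hxb]
    ring
  have hpq : inner ℝ p q = (0 : ℝ) := by
    rw [hq, real_inner_smul_right, inner_sub_right, inner_sub_right, real_inner_smul_right,
      real_inner_smul_right, hpp, real_inner_comm b p, hpb, hpx]
    ring
  have hqq : inner ℝ q q = (1 : ℝ) := by
    have h1 := hx
    rw [hxq] at h1
    simp only [inner_add_left, inner_add_right, real_inner_smul_left, real_inner_smul_right, hb,
      hpb, hpp, hbq, hpq, real_inner_comm b p, real_inner_comm b q, real_inner_comm p q] at h1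
    have : (Real.sin t * Real.sin β) ^ 2 * inner ℝ q q = (Real.sin t * Real.sin β) ^ 2 * 1 := by
      linear_combination h1 - Real.sin_sq_add_cos_sq t - Real.sin t ^ 2 * Real.sin_sq_add_cos_sq β
    exact mul_left_cancel₀ (pow_ne_zero 2 hne) this
  have ho : Ortho3 b p q := ⟨hb, hpp, hqq, hpb, hbq, hpq⟩
  have hck := ho.flap_eq hyp hs hxq (mul_pos ht hβ) hd ha hcb hcy hc hνb hνy hνx hνc
  -- The mirrored frame: its second axis is the direction of x at b and its third points to the side
  -- of y, so `flap_eq` applies to the other flap with x and y exchanged.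
  have ho' : Ortho3 b (Real.cos β • p + Real.sin β • q) (Real.sin β • p - Real.cos β • q) :=
    ho.of_inner_eq 1 0 0 0 (Real.cos β) (Real.sin β) 0 (Real.sin β) (-Real.cos β) (by module)
      (by module) (by module) (by ring) (by linear_combination Real.sin_sq_add_cos_sq β)
      (by linear_combination Real.sin_sq_add_cos_sq β) (by ring) (by ring) (by ring)
  have hcl := ho'.flap_eq (y := x) (x := y) (x₀ := Real.cos s) (x₁ := Real.sin s * Real.cos β)
    (x₂ := Real.sin s * Real.sin β) (by rw [hxq]; module) ht
    (by rw [hyp]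
        linear_combination (norm := module) (-Real.sin s * Real.sin_sq_add_cos_sq β) • p)
    (mul_pos hs hβ) hd ha' hcb' hcx hc' hνb' hνx' hνy' hνc'
  -- All angles are rewritten through h, φ = h + a and φ' = h + a'. The closing relation `hh` around
  -- b is used in β = 2π - (φ + φ').
  have e1 : a = (h + a) - h := by ring
  have e2 : β = 2 * Real.pi - ((h + a) + (h + a')) := by linarith
  have e3 : a' = (h + a') - h := by ring
  have hβ1 : Real.cos β = Real.cos (h + a) * Real.cos (h + a') -
      Real.sin (h + a) * Real.sin (h + a') := by
    rw [e2, Real.cos_two_pi_sub, Real.cos_add (h + a)]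
  have hβ2 : Real.sin β = -(Real.sin (h + a) * Real.cos (h + a') +
      Real.cos (h + a) * Real.sin (h + a')) := by
    rw [e2, Real.sin_two_pi_sub, Real.sin_add (h + a)]
  have ha1 := Real.cos_sub (h + a) h
  have ha2 := Real.sin_sub (h + a) h
  have ha1' := Real.cos_sub (h + a') h
  have ha2' := Real.sin_sub (h + a') h
  rw [← e1] at ha1 ha2
  rw [← e3] at ha1' ha2'
  have hA := Real.sin_sq_add_cos_sq (h + a)
  have hA' := Real.sin_sq_add_cos_sq (h + a')
  set φ := h + a
  set φ' := h + a'
  -- The frame p, q turned so that p, the direction of y, has polar angle φ; then e bisects the gap.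
  refine ⟨Real.cos φ • p - Real.sin φ • q, Real.sin φ • p + Real.cos φ • q, ?_, ?_, ?_, ?_, ?_⟩
  · refine ho.of_inner_eq 1 0 0 0 (Real.cos φ) (-Real.sin φ) 0 (Real.sin φ) (Real.cos φ)
      (by module) (by module) (by module) (by ring) (by linear_combination hA)
      (by linear_combination hA) (by ring) (by ring) (by ring)
  · rw [hck, ha1, ha2]
    module
  · rw [hcl, ha1', ha2', hβ1, hβ2]
    linear_combination (norm := module)
      (Real.sin d * (Real.cos φ * Real.cos h - Real.sin φ * Real.sin h) * hA') • p -
      (Real.sin d * (Real.sin φ * Real.cos h + Real.cos φ * Real.sin h) * hA') • q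
  · rw [hyp]
    linear_combination (norm := module) (-Real.sin s * hA) • p
  · rw [hxq, hβ1, hβ2]
    module

/-- The point at parameter τ has tangential part (-u cos τ, sin τ) along e, f. It has the direction
φ when tan τ = u sin φ / (-cos φ), which is positive as φ is obtuse. Comparing coefficients gives n,
then m = v cos τ - n cos s, which is positive because the edge is longer than π/2. -/
theorem exists_crossing (b e f : V) {u v φ s : ℝ} (hu : 0 < u) (hv : 0 < v)
    (hφ : φ ∈ Ioo (Real.pi / 2) Real.pi) (hs : Real.cos s < 0) (hs' : 0 < Real.sin s) :
    ∃ τ ∈ Ioo 0 (Real.pi / 2), ∃ m n : ℝ, 0 < m ∧ 0 < n ∧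
      Real.cos τ • (v • b - u • e) + Real.sin τ • f = m • b +
        n • (Real.cos s • b + Real.sin s • (Real.cos φ • e + Real.sin φ • f)) := by
  have hX : 0 < -Real.cos φ := neg_pos.2 (Real.cos_neg_of_pi_div_two_lt_of_lt hφ.1
    (by linarith [Real.pi_pos, hφ.2]))
  have hY : 0 < u * Real.sin φ := mul_pos hu
    (Real.sin_pos_of_pos_of_lt_pi (by linarith [Real.pi_pos, hφ.1]) hφ.2)
  set τ := Real.arctan (u * Real.sin φ / -Real.cos φ) with hτ
  have hτ0 : 0 < τ := Real.arctan_pos.2 (div_pos hY hX)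
  have hc : 0 < Real.cos τ := Real.cos_arctan_pos _
  have ht : Real.sin τ = Real.cos τ * (u * Real.sin φ / -Real.cos φ) := by
    rw [← Real.tan_arctan (u * Real.sin φ / -Real.cos φ), ← hτ, mul_comm,
      Real.tan_mul_cos hc.ne']
  refine ⟨τ, ⟨hτ0, Real.arctan_lt_pi_div_two _⟩,
    Real.cos τ / -Real.cos φ * (-Real.cos φ * v + u * -Real.cos s / Real.sin s),
    Real.cos τ / -Real.cos φ * (u / Real.sin s),
    mul_pos (div_pos hc hX) (add_pos (mul_pos hX hv) (div_pos (mul_pos hu (by linarith)) hs')),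
    mul_pos (div_pos hc hX) (div_pos hu hs'), ?_⟩
  rw [ht]
  have hX' : Real.cos φ ≠ 0 := by linarith
  match_scalars <;> field_simp
  ring

end Ortho3

/-! ### The great circle through the two copies of the cut vertex. -/

namespace Ortho3

/-- The great circle through the two copies `c`, `c'` of the cut vertex, and its crossings with
the edges `b y` and `b x`. -/
theorem exists_arc {V : Type*} [NormedAddCommGroup V] [InnerProductSpace ℝ V]
    {b e f c c' x y : V} (ho : Ortho3 b e f) {d s t h φ φ' : ℝ}
    (hd : d ∈ Ioo (Real.pi / 2) Real.pi) (hs : s ∈ Ioo (Real.pi / 2) Real.pi)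
    (ht : t ∈ Ioo (Real.pi / 2) Real.pi) (hh : h ∈ Ioo 0 (Real.pi / 2))
    (hφ : φ ∈ Ioo (Real.pi / 2) Real.pi) (hφ' : φ' ∈ Ioo (Real.pi / 2) Real.pi)
    (hc : c = Real.cos d • b + Real.sin d • (Real.cos h • e + Real.sin h • f))
    (hc' : c' = Real.cos d • b + Real.sin d • (Real.cos h • e - Real.sin h • f))
    (hy : y = Real.cos s • b + Real.sin s • (Real.cos φ • e + Real.sin φ • f))
    (hx : x = Real.cos t • b + Real.sin t • (Real.cos φ' • e - Real.sin φ' • f)) :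
    ∃ O E, Ortho3 O E f ∧ 0 < (inner ℝ O b : ℝ) ∧ inner ℝ O x < (0 : ℝ) ∧
      inner ℝ O y < (0 : ℝ) ∧
      ∃ τ ∈ Ioo (Real.pi / 2) Real.pi, c = Real.cos τ • E + Real.sin τ • f ∧
        c' = Real.cos τ • E - Real.sin τ • f ∧
        (∃ τ₁ ∈ Ioo 0 (Real.pi / 2), ∃ m n : ℝ, 0 < m ∧ 0 < n ∧
          Real.cos τ₁ • E + Real.sin τ₁ • f = m • b + n • y) ∧
        (∃ τ₂ ∈ Ioo 0 (Real.pi / 2), ∃ m n : ℝ, 0 < m ∧ 0 < n ∧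
          Real.cos τ₂ • E - Real.sin τ₂ • f = m • b + n • x) := by
  have hcos : ∀ {z : ℝ}, z ∈ Ioo (Real.pi / 2) Real.pi → Real.cos z < 0 := fun {z} hz =>
    Real.cos_neg_of_pi_div_two_lt_of_lt hz.1 (by linarith [Real.pi_pos, hz.2])
  have hsin : ∀ {z : ℝ}, z ∈ Ioo (Real.pi / 2) Real.pi → 0 < Real.sin z := fun {z} hz =>
    Real.sin_pos_of_pos_of_lt_pi (by linarith [Real.pi_pos, hz.1]) hz.2
  have hch : 0 < Real.cos h := Real.cos_pos_of_mem_Ioo ⟨by linarith [Real.pi_pos, hh.1], hh.2⟩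
  have hsh : 0 < Real.sin h := Real.sin_pos_of_pos_of_lt_pi hh.1 (by linarith [Real.pi_pos, hh.2])
  have hcd := hcos hd
  have hsd := hsin hd
  have hdd := Real.sin_sq_add_cos_sq d
  have hhh := Real.sin_sq_add_cos_sq h
  -- N is the length of the common projection of c and c' to the plane of b and e. That projection
  -- is -N • E, so cos τ = -N; N < 1 because sin d sin h > 0.
  obtain ⟨N, hN0, hN2⟩ : ∃ N : ℝ, 0 < N ∧
      N ^ 2 = (Real.sin d * Real.cos h) ^ 2 + Real.cos d ^ 2 :=
    ⟨_, Real.sqrt_pos.2 (by positivity), Real.sq_sqrt (by positivity)⟩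
  have hN1 : N < 1 := by
    have : 0 < (Real.sin d * Real.sin h) ^ 2 := by positivity
    nlinarith
  obtain ⟨u, hu⟩ : ∃ u, u = Real.sin d * Real.cos h / N := ⟨_, rfl⟩
  obtain ⟨v, hv⟩ : ∃ v, v = -Real.cos d / N := ⟨_, rfl⟩
  have hu0 : 0 < u := by rw [hu]; positivity
  have hv0 : 0 < v := by rw [hv]; exact div_pos (by linarith) hN0
  have huN : u * N = Real.sin d * Real.cos h := by rw [hu]; field_simp
  have hvN : v * N = -Real.cos d := by rw [hv]; field_simp
  have huv : u ^ 2 + v ^ 2 = 1 := by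
    rw [hu, hv, div_pow, div_pow, ← add_div, div_eq_one_iff_eq (by positivity), hN2]
    ring
  have hτc : Real.cos (Real.arccos (-N)) = -N := Real.cos_arccos (by linarith) (by linarith)
  have hτs : Real.sin (Real.arccos (-N)) = Real.sin d * Real.sin h := by
    rw [Real.sin_arccos, Real.sqrt_eq_iff_mul_self_eq_of_pos (by positivity)]
    linear_combination hdd + hN2 + Real.sin d ^ 2 * hhh
  have hO : u • b + v • e = u • b + v • e + (0 : ℝ) • f := by module
  -- The pole O is the unit vector in the plane of b and e, orthogonal to that projection, with
  -- positive coefficients u and v. Both signs come from cos d < 0 < sin d cos h.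
  refine ⟨u • b + v • e, v • b - u • e, ?_, ?_, ?_, ?_, Real.arccos (-N), ⟨?_, ?_⟩, ?_, ?_, ?_, ?_⟩
  · exact ho.of_inner_eq u v 0 v (-u) 0 0 0 1 (by module) (by module) (by module)
      (by linear_combination huv) (by linear_combination huv) (by ring) (by ring) (by ring)
      (by ring)
  · have := ho.inner_eq u v 0 1 0 0
    rw [← hO, show (1 : ℝ) • b + (0 : ℝ) • e + (0 : ℝ) • f = b by module] at this
    rw [this]
    linarith
  · have hx' : x = Real.cos t • b + (Real.sin t * Real.cos φ') • e +
        (-(Real.sin t * Real.sin φ')) • f := by rw [hx]; module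
    rw [hx', hO, ho.inner_eq]
    nlinarith [mul_neg_of_pos_of_neg hu0 (hcos ht),
      mul_neg_of_pos_of_neg (mul_pos hv0 (hsin ht)) (hcos hφ')]
  · have hy' : y = Real.cos s • b + (Real.sin s * Real.cos φ) • e +
        (Real.sin s * Real.sin φ) • f := by rw [hy]; module
    rw [hy', hO, ho.inner_eq]
    nlinarith [mul_neg_of_pos_of_neg hu0 (hcos hs),
      mul_neg_of_pos_of_neg (mul_pos hv0 (hsin hs)) (hcos hφ)]
  · rw [← not_le, Real.arccos_le_pi_div_two]
    linarith
  · refine lt_of_le_of_ne (Real.arccos_le_pi _) fun h0 => ?_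
    rw [Real.arccos_eq_pi] at h0
    linarith
  · rw [hτc, hτs, hc]
    linear_combination (norm := module) hvN • b - huN • e
  · rw [hτc, hτs, hc']
    linear_combination (norm := module) hvN • b - huN • e
  · rw [hy]
    exact exists_crossing b e f hu0 hv0 hφ (hcos hs) (hsin hs)
  -- The second crossing is the mirror image of the first under f ↦ -f.
  · obtain ⟨τ, hτ, m, n, hm, hn, h0⟩ :=
      exists_crossing b e (-f) hu0 hv0 hφ' (hcos ht) (hsin ht)
    exact ⟨τ, hτ, m, n, hm, hn, by rw [hx]; linear_combination (norm := module) h0⟩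

end Ortho3

/-! ### Existence of the unfolding. -/

/-- Equal Gram matrices make the family u independent too, hence a basis, and the linear map sending
u to v preserves inner products. -/
theorem exists_linearIsometry_of_inner_eq {u : Fin 3 → EuclideanSpace ℝ (Fin 3)}
    {v : Fin 3 → EuclideanSpace ℝ (Fin 4)} (hv : LinearIndependent ℝ v)
    (h : ∀ m n, inner ℝ (u m) (u n) = (inner ℝ (v m) (v n) : ℝ)) :
    ∃ L : EuclideanSpace ℝ (Fin 3) →ₗᵢ[ℝ] EuclideanSpace ℝ (Fin 4), ∀ m, L (u m) = v m := by
  have key : ∀ g g' : Fin 3 → ℝ, inner ℝ (∑ m, g m • u m) (∑ m, g' m • u m) =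
      (inner ℝ (∑ m, g m • v m) (∑ m, g' m • v m) : ℝ) := by
    intro g g'
    simp only [sum_inner, inner_sum, real_inner_smul_left, real_inner_smul_right, h]
  have hu : LinearIndependent ℝ u := by
    rw [Fintype.linearIndependent_iff] at hv ⊢
    intro g hg
    refine hv g ?_
    rw [← inner_self_eq_zero (𝕜 := ℝ), ← key, hg, inner_zero_left]
  let e := basisOfLinearIndependentOfCardEqFinrank hu (by simp)
  have he : ∀ m, e m = u m := fun m => by simp [e]
  refine ⟨(e.constr ℝ v).isometryOfInner fun x y => ?_, fun m => ?_⟩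
  · rw [← e.sum_repr x, ← e.sum_repr y]
    simp only [map_sum, map_smul, Module.Basis.constr_basis]
    simp only [he]
    exact (key _ _).symm
  · rw [← he]
    exact e.constr_basis ℝ v m

theorem exists_add_orthogonal_pair {V : Type*} [NormedAddCommGroup V] [InnerProductSpace ℝ V]
    (x y v : V) : ∃ (s t : ℝ) (r : V), v = s • x + t • y + r ∧ inner ℝ x r = (0 : ℝ) ∧
      inner ℝ y r = (0 : ℝ) := by
  have := FiniteDimensional.span_of_finite ℝ (Set.toFinite {x, y})
  obtain ⟨w, hw, r, hr, rfl⟩ := (Submodule.span ℝ {x, y}).exists_add_mem_mem_orthogonal v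
  obtain ⟨s, t, rfl⟩ := Submodule.mem_span_pair.1 hw
  exact ⟨s, t, r, rfl, hr x (Submodule.subset_span (by simp)),
    hr y (Submodule.subset_span (by simp))⟩

/-- The unfolded position of a vertex `w` of the triangle `w x y` in the plane of `x y z`. -/
theorem exists_flap {x y z w : EuclideanSpace ℝ (Fin 4)}
    (hind : ∀ q r s t : ℝ, q • w + r • z + s • x + t • y = 0 → q = 0 ∧ r = 0 ∧ s = 0 ∧ t = 0)
    (J : EuclideanSpace ℝ (Fin 3) →ₗᵢ[ℝ] EuclideanSpace ℝ (Fin 4))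
    {x' y' z' : EuclideanSpace ℝ (Fin 3)} (hx : J x' = x) (hy : J y' = y) (hz : J z' = z) :
    ∃ c ν : EuclideanSpace ℝ (Fin 3), ‖c‖ = ‖w‖ ∧ inner ℝ c x' = (inner ℝ w x : ℝ) ∧
      inner ℝ c y' = (inner ℝ w y : ℝ) ∧ inner ℝ ν x' = (0 : ℝ) ∧ inner ℝ ν y' = (0 : ℝ) ∧
      inner ℝ ν z' < (0 : ℝ) ∧ (0 : ℝ) < inner ℝ ν c := by
  obtain ⟨s, t, q, hq, hqx, hqy⟩ := exists_add_orthogonal_pair x y z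
  obtain ⟨s', t', r, hr, hrx, hry⟩ := exists_add_orthogonal_pair x y w
  have hq0 : 0 < ‖q‖ := norm_pos_iff.2 fun h0 => by
    have := hind 0 1 (-s) (-t) (by rw [hq, h0]; module)
    exact one_ne_zero this.2.1
  have hr0 : 0 < ‖r‖ := norm_pos_iff.2 fun h0 => by
    have := hind 1 0 (-s') (-t') (by rw [hr, h0]; module)
    exact one_ne_zero this.1
  have hJq : J (z' - s • x' - t • y') = q := by
    rw [map_sub, map_sub, map_smul, map_smul, hx, hy, hz, hq]; module
  have hq2 : inner ℝ q q = ‖q‖ ^ 2 := real_inner_self_eq_norm_sq q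
  have hr2 : inner ℝ r r = ‖r‖ ^ 2 := real_inner_self_eq_norm_sq r
  have hxq := real_inner_comm x q
  have hyq := real_inner_comm y q
  have hxr := real_inner_comm x r
  have hyr := real_inner_comm y r
  rw [hqx] at hxq
  rw [hqy] at hyq
  rw [hrx] at hxr
  rw [hry] at hyr
  -- The component of w along x, y is kept. The orthogonal remainder r is turned about the edge into
  -- the plane of the triangle, keeping its length and pointing against the remainder q of z; -q
  -- serves as the normal.
  refine ⟨s' • x' + t' • y' - (‖r‖ / ‖q‖) • (z' - s • x' - t • y'), -(z' - s • x' - t • y'),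
    ?_, ?_, ?_, ?_, ?_, ?_, ?_⟩
  · rw [← J.norm_map, ← sq_eq_sq₀ (norm_nonneg _) (norm_nonneg _), ← real_inner_self_eq_norm_sq,
      ← real_inner_self_eq_norm_sq, map_sub, map_add, map_smul, map_smul, map_smul, hJq, hx, hy,
      hr]
    simp only [inner_add_left, inner_add_right, inner_sub_left, inner_sub_right,
      real_inner_smul_left, real_inner_smul_right, hqx, hqy, hrx, hry, hxq, hyq, hxr, hyr, hq2, hr2]
    field_simp
    ring
  · rw [← J.inner_map_map, map_sub, map_add, map_smul, map_smul, map_smul, hJq, hx, hy, hr]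
    simp only [inner_add_left, inner_sub_left, real_inner_smul_left, hxq, hxr]
    ring
  · rw [← J.inner_map_map, map_sub, map_add, map_smul, map_smul, map_smul, hJq, hx, hy, hr]
    simp only [inner_add_left, inner_sub_left, real_inner_smul_left, hyq, hyr]
    ring
  · rw [← J.inner_map_map, map_neg, hJq, hx, inner_neg_left, hxq, neg_zero]
  · rw [← J.inner_map_map, map_neg, hJq, hy, inner_neg_left, hyq, neg_zero]
  · rw [← J.inner_map_map, map_neg, hJq, hz, hq, inner_neg_left, inner_add_right, inner_add_right,
      real_inner_smul_right, real_inner_smul_right, hxq, hyq, hq2]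
    have := pow_pos hq0 2
    linarith
  · rw [← J.inner_map_map, map_neg, hJq, map_sub, map_add, map_smul, map_smul, map_smul, hJq, hx,
      hy,
      inner_neg_left, inner_sub_right, inner_add_right, real_inner_smul_right,
      real_inner_smul_right, real_inner_smul_right, hxq, hyq, hq2]
    have : 0 < ‖r‖ / ‖q‖ * ‖q‖ ^ 2 := by positivity
    linarith

theorem IsTetrahedron.exists_isUnfolding {A : Fin 4 → Sph 3} (hA : IsTetrahedron A) (i : Fin 4) :
    ∃ B C, IsUnfolding A i B C := by
  have hli : LinearIndependent ℝ (fun m : {m // m ≠ i} => (A m).vec) :=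
    LinearIndependent.comp hA _ Subtype.val_injective
  have hrank : Module.finrank ℝ (Submodule.span ℝ (range fun m : {m // m ≠ i} => (A m).vec)) =
      3 := by
    rw [finrank_span_eq_card hli]
    simp
  let S := Submodule.span ℝ (range fun m : {m // m ≠ i} => (A m).vec)
  let ψ : S ≃ₗᵢ[ℝ] EuclideanSpace ℝ (Fin 3) :=
    ((stdOrthonormalBasis ℝ S).reindex (finCongr hrank)).repr
  let J : EuclideanSpace ℝ (Fin 3) →ₗᵢ[ℝ] EuclideanSpace ℝ (Fin 4) :=
    S.subtypeₗᵢ.comp ψ.symm.toLinearIsometry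
  have hB : ∀ m, ∃ x : Sph 2, m ≠ i → J x.vec = (A m).vec := by
    intro m
    have aux : ∀ m, m ≠ i → ∃ x : Sph 2, J x.vec = (A m).vec := fun m hm => by
      have hJ : J (ψ ⟨(A m).vec, Submodule.subset_span ⟨⟨m, hm⟩, rfl⟩⟩) = (A m).vec := by
        simp [J]
      exact ⟨⟨_, by rw [← J.norm_map, hJ, (A m).norm_vec]⟩, hJ⟩
    by_cases hm : m = i
    · obtain ⟨n, hn⟩ : ∃ n, n ≠ i := exists_ne i
      obtain ⟨x, -⟩ := aux n hn
      exact ⟨x, fun h => absurd hm h⟩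
    · obtain ⟨x, hx⟩ := aux m hm
      exact ⟨x, fun _ => hx⟩
  choose B hB using hB
  have hC : ∀ m, ∃ c : Sph 2, m ≠ i → ∀ n p, [i, m, n, p].Nodup →
      dist c (B n) = dist (A i) (A n) ∧ dist c (B p) = dist (A i) (A p) ∧
      OppositeSides (B n) (B p) (B m) c := by
    intro m
    by_cases hm : m = i
    · exact ⟨B m, fun h => absurd hm h⟩
    obtain ⟨n, p, h⟩ : ∃ n p, [i, m, n, p].Nodup := by
      clear * - hm
      revert i m; decide
    have hn : n ≠ i ∧ p ≠ i := by
      simp only [List.nodup_cons, List.mem_cons, List.not_mem_nil, or_false, not_or] at h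
      exact ⟨Ne.symm h.1.2.1, Ne.symm h.1.2.2⟩
    obtain ⟨c, ν, h1, h2, h3, h4, h5, h6, h7⟩ := exists_flap (hA.coeff h) J
      (hB n hn.1) (hB p hn.2) (hB m hm)
    refine ⟨⟨c, h1.trans (A i).norm_vec⟩, fun _ n' p' h' => ?_⟩
    have hcases : n' = n ∧ p' = p ∨ n' = p ∧ p' = n := by
      clear * - h h'
      revert i m n p n' p'; decide
    rcases hcases with ⟨rfl, rfl⟩ | ⟨rfl, rfl⟩
    · exact ⟨(Sph.dist_eq_iff _ _ _ _).2 h2, (Sph.dist_eq_iff _ _ _ _).2 h3, ν, h4, h5, h6, h7⟩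
    · exact ⟨(Sph.dist_eq_iff _ _ _ _).2 h3, (Sph.dist_eq_iff _ _ _ _).2 h2, ν, h5, h4, h6, h7⟩
  choose C hC using hC
  refine ⟨B, C, fun m n hm hn => ?_, fun m n hm hn hnm => ?_, fun m n p h => ?_⟩
  · rw [Sph.dist_eq_iff, ← J.inner_map_map, hB m hm, hB n hn]
  · obtain ⟨p, h⟩ : ∃ p, [i, m, n, p].Nodup := by
      clear * - hm hn hnm
      revert i m n; decide
    exact (hC m hm n p h).1
  · refine (hC m ?_ n p h).2.2
    simp only [List.nodup_cons, List.mem_cons, List.not_mem_nil, or_false, not_or] at h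
    exact Ne.symm h.1.1

/-! ### Closed faces and lower bounds for the intrinsic distance. -/

theorem Sph.dist_eq_of_map {n m : ℕ}
    (L : EuclideanSpace ℝ (Fin (n + 1)) →ₗᵢ[ℝ] EuclideanSpace ℝ (Fin (m + 1)))
    {x x' : Sph n} {y y' : Sph m} (h : L x.vec = y.vec) (h' : L x'.vec = y'.vec) :
    dist x x' = dist y y' := by
  rw [Sph.dist_eq_iff, ← h, ← h', L.inner_map_map]

theorem Sph.norm_sub_le_dist {n : ℕ} (x y : Sph n) : ‖x.vec - y.vec‖ ≤ dist x y := by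
  refine le_of_sq_le_sq ?_ dist_nonneg
  rw [norm_sub_sq_real, x.norm_vec, y.norm_vec, ← Sph.cos_dist]
  linarith [Real.one_sub_sq_div_two_le_cos (x := dist x y)]

theorem Sph.continuous_vec {n : ℕ} : Continuous (Sph.vec : Sph n → _) :=
  (LipschitzWith.of_dist_le_mul (K := 1) fun x y => by
    simpa [dist_eq_norm] using Sph.norm_sub_le_dist x y).continuous

/-- A face is cut out by conditions on the coordinates in the basis of the vertices, and these are
continuous. Closedness serves to find the moment a curve changes faces and to keep a crossing away
from the far faces. -/
theorem IsTetrahedron.isClosed_face {A : Fin 4 → Sph 3} (hA : IsTetrahedron A) (k : Fin 4) :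
    IsClosed (face A k) := by
  let e := basisOfLinearIndependentOfCardEqFinrank hA (by simp)
  have he : ∀ m, e m = (A m).vec := fun m =>
    congrFun (coe_basisOfLinearIndependentOfCardEqFinrank hA _) m
  have hcont : ∀ m, Continuous fun x : Sph 3 => e.coord m x.vec := fun m =>
    (e.coord m).continuous_of_finiteDimensional.comp Sph.continuous_vec
  have heq : face A k = (⋂ m, {x | 0 ≤ e.coord m x.vec}) ∩ {x | e.coord k x.vec = 0} := by
    ext x
    simp only [mem_inter_iff, mem_iInter, mem_ofPred_eq]
    constructor
    · rintro ⟨w, hw, hk, hx⟩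
      have : ∀ m, e.coord m x.vec = w m := fun m => by
        rw [hx]
        simp only [← he, map_sum, map_smul, Module.Basis.coord_apply, Module.Basis.repr_self,
          Finsupp.single_apply, smul_eq_mul, mul_ite, mul_one, mul_zero]
        simp
      exact ⟨fun m => (this m).symm ▸ hw m, by rw [this, hk]⟩
    · rintro ⟨h1, h2⟩
      refine ⟨fun m => e.coord m x.vec, h1, h2, ?_⟩
      simp only [← he]
      exact (e.sum_repr x.vec).symm
  rw [heq]
  exact (isClosed_iInter fun m => isClosed_le continuous_const (hcont m)).inter
    (isClosed_eq (hcont k) continuous_const)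

theorem IsTetrahedron.notMem_face {A : Fin 4 → Sph 3} (hA : IsTetrahedron A) {x : Sph 3}
    {w : Fin 4 → ℝ} (hx : x.vec = ∑ m, w m • (A m).vec) {k : Fin 4} (hk : w k ≠ 0) :
    x ∉ face A k := by
  rintro ⟨v, -, hv, hx'⟩
  rw [hA.weights_unique (hx'.symm.trans hx)] at hv
  exact hk hv

theorem dist_le_intrinsicEDist {X : Type*} [MetricSpace X] (M : Set X) (p q : X) :
    ENNReal.ofReal (dist p q) ≤ intrinsicEDist M p q := by
  refine le_iInf₂ fun c hc => ?_
  rw [← edist_dist, ← hc.2.2.1, ← hc.2.2.2]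
  exact eVariationOn.edist_le c (left_mem_Icc.2 zero_le_one) (right_mem_Icc.2 zero_le_one)

theorem intrinsicEDist_le {X : Type*} [MetricSpace X] {M : Set X} {γ : ℝ → X} {s u : ℝ}
    (hsu : s ≤ u) (hc : ContinuousOn γ (Icc s u)) (hM : MapsTo γ (Icc s u) M) :
    intrinsicEDist M (γ s) (γ u) ≤ eVariationOn γ (Icc s u) := by
  have hmaps : MapsTo (fun x : ℝ => s + (u - s) * x) (Icc 0 1) (Icc s u) := fun x hx =>
    ⟨by nlinarith [hx.1], by nlinarith [hx.2]⟩
  have hmono : MonotoneOn (fun x : ℝ => s + (u - s) * x) (Icc 0 1) := fun x _ y _ hxy => by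
    simp only
    nlinarith
  refine (iInf₂_le (γ ∘ fun x : ℝ => s + (u - s) * x) ⟨hc.comp (by fun_prop) hmaps,
    hM.comp hmaps, by simp, by simp⟩).trans ?_
  exact eVariationOn.comp_le_of_monotoneOn γ _ hmono hmaps

/-- A curve on the surface joining two adjacent faces is at least as long as the distance in
their unfolding, or as the distance to the other faces. -/
theorem IsTetrahedron.dist_le_intrinsicEDist_of_adjacent {A : Fin 4 → Sph 3}
    (hA : IsTetrahedron A) {p q r r' : Fin 4} (hn : [p, q, r, r'].Nodup) {x y : Sph 3}
    {x' y' b b' : Sph 2} {L L' : EuclideanSpace ℝ (Fin 3) →ₗᵢ[ℝ] EuclideanSpace ℝ (Fin 4)}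
    (hb : L b.vec = (A r).vec) (hb' : L b'.vec = (A r').vec) (hx : L x'.vec = x.vec)
    (hLb : L' b.vec = (A r).vec) (hLb' : L' b'.vec = (A r').vec) (hy : L' y'.vec = y.vec)
    (hxp : x ∈ face A p) (hyq : y ∈ face A q)
    (hfar : ∀ z ∈ face A r ∪ face A r', dist x' y' ≤ dist x z) :
    ENNReal.ofReal (dist x' y') ≤ intrinsicEDist (surface A) x y := by
  refine le_iInf₂ fun c ⟨hc, hcM, hc0, hc1⟩ => ?_
  have h0 : (0 : ℝ) ∈ Icc (0 : ℝ) 1 := left_mem_Icc.2 zero_le_one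
  have h1 : (1 : ℝ) ∈ Icc (0 : ℝ) 1 := right_mem_Icc.2 zero_le_one
  by_cases hcase : ∃ v ∈ Icc (0 : ℝ) 1, c v ∈ face A r ∪ face A r'
  · obtain ⟨v, hv, hcv⟩ := hcase
    refine le_trans ?_ (eVariationOn.edist_le c h0 hv)
    rw [edist_dist, hc0]
    exact ENNReal.ofReal_le_ofReal (hfar _ hcv)
  have hcover : Icc (0 : ℝ) 1 ⊆ Icc 0 1 ∩ c ⁻¹' face A p ∪ Icc 0 1 ∩ c ⁻¹' face A q := by
    intro v hv
    obtain ⟨m, hm⟩ := mem_iUnion.1 (hcM hv)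
    rcases Fin4.cases hn m with rfl | rfl | rfl | rfl
    · exact Or.inl ⟨hv, hm⟩
    · exact Or.inr ⟨hv, hm⟩
    · exact absurd ⟨v, hv, Or.inl hm⟩ hcase
    · exact absurd ⟨v, hv, Or.inr hm⟩ hcase
  -- By connectedness of the interval the curve has a point in both near faces, hence on their
  -- common edge, where both foldings agree. So this point has a single position z in the unfolding.
  obtain ⟨v, hv, ⟨-, hvp⟩, -, hvq⟩ := isPreconnected_closed_iff.1
    (isPreconnected_Icc (a := (0 : ℝ)) (b := 1)) _ _
    (hc.preimage_isClosed_of_isClosed isClosed_Icc (hA.isClosed_face p))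
    (hc.preimage_isClosed_of_isClosed isClosed_Icc (hA.isClosed_face q)) hcover
    ⟨0, h0, h0, by rwa [mem_preimage, hc0]⟩ ⟨1, h1, h1, by rwa [mem_preimage, hc1]⟩
  obtain ⟨w, -, hwp, hw⟩ := hvp
  have hwq : w q = 0 := by
    by_contra hne
    exact hA.notMem_face hw hne hvq
  rw [Fin4.sum_eq hn, hwp, hwq, zero_smul, zero_smul, zero_add, zero_add] at hw
  have hL : L (w r • b.vec + w r' • b'.vec) = (c v).vec := by
    rw [map_add, map_smul, map_smul, hb, hb', hw]
  have hL' : L' (w r • b.vec + w r' • b'.vec) = (c v).vec := by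
    rw [map_add, map_smul, map_smul, hLb, hLb', hw]
  let z : Sph 2 := ⟨w r • b.vec + w r' • b'.vec, by rw [← L.norm_map, hL, (c v).norm_vec]⟩
  have hxz : dist x' z = dist x (c v) := Sph.dist_eq_of_map L hx hL
  have hzy : dist z y' = dist (c v) y := Sph.dist_eq_of_map L' hL' hy
  calc ENNReal.ofReal (dist x' y') ≤ ENNReal.ofReal (dist x' z + dist z y') :=
        ENNReal.ofReal_le_ofReal (dist_triangle _ _ _)
    _ = edist (c 0) (c v) + edist (c v) (c 1) := by
        rw [hxz, hzy, ENNReal.ofReal_add dist_nonneg dist_nonneg, hc0, hc1, edist_dist, edist_dist]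
    _ ≤ eVariationOn c (Icc 0 v) + eVariationOn c (Icc v 1) :=
        add_le_add (eVariationOn.edist_le c (left_mem_Icc.2 hv.1) (right_mem_Icc.2 hv.1))
          (eVariationOn.edist_le c (left_mem_Icc.2 hv.2) (right_mem_Icc.2 hv.2))
    _ ≤ eVariationOn c (Icc 0 1) := by
        have := eVariationOn.Icc_add_Icc c (s := univ) hv.1 hv.2 (mem_univ v)
        simp only [univ_inter] at this
        exact this.le

/-- `γ` runs with constant speed `K` along the arc `σ` of the unfolding, folded back on the faces
opposite to `A k`, `A i` and `A l` by `L₁`, `L₂` and `L₃`, and changes faces at `t₁` and `t₂`. -/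
structure FoldedArc (A : Fin 4 → Sph 3) (i j k l : Fin 4) (B C : Fin 4 → Sph 2) (σ : ℝ → Sph 2)
    (γ : ℝ → Sph 3) (K t₁ t₂ : ℝ)
    (L₁ L₂ L₃ : EuclideanSpace ℝ (Fin 3) →ₗᵢ[ℝ] EuclideanSpace ℝ (Fin 4)) : Prop where
  nodup : [i, j, k, l].Nodup
  K_pos : 0 < K
  t₁_pos : 0 < t₁
  t₁_lt_t₂ : t₁ < t₂
  t₂_lt_one : t₂ < 1
  dist_eq : ∀ s u, K * |s - u| ≤ Real.pi → dist (σ s) (σ u) = K * |s - u|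
  injOn : InjOn σ (Icc 0 1)
  start : σ 0 = C k
  finish : σ 1 = C l
  L₁_C : L₁ (C k).vec = (A i).vec
  L₁_B : ∀ m, m ≠ i → m ≠ k → L₁ (B m).vec = (A m).vec
  L₂_B : ∀ m, m ≠ i → L₂ (B m).vec = (A m).vec
  L₃_C : L₃ (C l).vec = (A i).vec
  L₃_B : ∀ m, m ≠ i → m ≠ l → L₃ (B m).vec = (A m).vec
  map₁ : ∀ t ∈ Icc 0 t₁, L₁ (σ t).vec = (γ t).vec
  map₂ : ∀ t ∈ Icc t₁ t₂, L₂ (σ t).vec = (γ t).vec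
  map₃ : ∀ t ∈ Icc t₂ 1, L₃ (σ t).vec = (γ t).vec
  weights : ∀ t ∈ Icc (0 : ℝ) 1, ∃ w : Fin 4 → ℝ, (∀ m, 0 ≤ w m) ∧
    (γ t).vec = ∑ m, w m • (A m).vec ∧ (t ≤ t₁ → w k = 0) ∧ (t₁ ≤ t → t ≤ t₂ → w i = 0) ∧
    (t₂ ≤ t → w l = 0) ∧ (t < t₁ → 0 < w i) ∧ (t₂ < t → 0 < w i) ∧
    (0 < t → t < 1 → 0 < w j) ∧ (0 < t → t < t₂ → 0 < w l) ∧ (t₁ < t → t < 1 → 0 < w k)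

/-! ### Faces met by a folded arc, and its Lipschitz bound. -/

namespace FoldedArc

variable {A : Fin 4 → Sph 3} {i j k l : Fin 4} {B C : Fin 4 → Sph 2} {σ : ℝ → Sph 2}
    {γ : ℝ → Sph 3} {K t₁ t₂ : ℝ}
    {L₁ L₂ L₃ : EuclideanSpace ℝ (Fin 3) →ₗᵢ[ℝ] EuclideanSpace ℝ (Fin 4)}

theorem mem_face₁ (h : FoldedArc A i j k l B C σ γ K t₁ t₂ L₁ L₂ L₃) {t : ℝ} (ht : t ∈ Icc 0 t₁) :
    γ t ∈ face A k := by
  obtain ⟨w, h0, hw, h1, -⟩ := h.weights t ⟨ht.1, by linarith [ht.2, h.t₁_lt_t₂, h.t₂_lt_one]⟩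
  exact ⟨w, h0, h1 ht.2, hw⟩

theorem mem_face₂ (h : FoldedArc A i j k l B C σ γ K t₁ t₂ L₁ L₂ L₃) {t : ℝ}
    (ht : t ∈ Icc t₁ t₂) : γ t ∈ face A i := by
  obtain ⟨w, h0, hw, -, h1, -⟩ := h.weights t
    ⟨by linarith [ht.1, h.t₁_pos], by linarith [ht.2, h.t₂_lt_one]⟩
  exact ⟨w, h0, h1 ht.1 ht.2, hw⟩

theorem mem_face₃ (h : FoldedArc A i j k l B C σ γ K t₁ t₂ L₁ L₂ L₃) {t : ℝ} (ht : t ∈ Icc t₂ 1) :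
    γ t ∈ face A l := by
  obtain ⟨w, h0, hw, -, -, h1, -⟩ := h.weights t
    ⟨by linarith [ht.1, h.t₁_lt_t₂, h.t₁_pos], ht.2⟩
  exact ⟨w, h0, h1 ht.1, hw⟩

/-- Together with `exists_relint` this tells the loops of different j apart. -/
theorem exists_mem_face (h : FoldedArc A i j k l B C σ γ K t₁ t₂ L₁ L₂ L₃) {t : ℝ}
    (ht : t ∈ Icc (0 : ℝ) 1) : ∃ m, m ≠ j ∧ γ t ∈ face A m := by
  have hn := h.nodup
  simp only [List.nodup_cons, List.mem_cons, List.not_mem_nil, or_false, not_or] at hn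
  rcases le_total t t₁ with h1 | h1
  · exact ⟨k, Ne.symm hn.2.1.1, h.mem_face₁ ⟨ht.1, h1⟩⟩
  rcases le_total t t₂ with h2 | h2
  · exact ⟨i, hn.1.1, h.mem_face₂ ⟨h1, h2⟩⟩
  · exact ⟨l, Ne.symm hn.2.1.2, h.mem_face₃ ⟨h2, ht.2⟩⟩

theorem exists_relint (h : FoldedArc A i j k l B C σ γ K t₁ t₂ L₁ L₂ L₃) {m : Fin 4} (hmi : m ≠ i)
    (hmj : m ≠ j) : ∃ t ∈ Icc (0 : ℝ) 1, ∃ w : Fin 4 → ℝ,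
      (γ t).vec = ∑ n, w n • (A n).vec ∧ ∀ n, n ≠ m → 0 < w n := by
  have := h.t₁_pos
  have := h.t₁_lt_t₂
  have := h.t₂_lt_one
  rcases Fin4.cases h.nodup m with rfl | rfl | rfl | rfl
  · exact absurd rfl hmi
  · exact absurd rfl hmj
  · have ht : t₁ / 2 ∈ Icc (0 : ℝ) 1 := ⟨by linarith, by linarith⟩
    obtain ⟨w, -, hw, -, -, -, h1, -, h2, h3, -⟩ := h.weights _ ht
    refine ⟨_, ht, w, hw, fun n hn => ?_⟩
    rcases Fin4.cases h.nodup n with rfl | rfl | rfl | rfl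
    exacts [h1 (by linarith), h2 (by linarith) (by linarith), absurd rfl hn,
      h3 (by linarith) (by linarith)]
  · have ht : (t₂ + 1) / 2 ∈ Icc (0 : ℝ) 1 := ⟨by linarith, by linarith⟩
    obtain ⟨w, -, hw, -, -, -, -, h1, h2, -, h3⟩ := h.weights _ ht
    refine ⟨_, ht, w, hw, fun n hn => ?_⟩
    rcases Fin4.cases h.nodup n with rfl | rfl | rfl | rfl
    exacts [h1 (by linarith), h2 (by linarith) (by linarith), h3 (by linarith) (by linarith),
      absurd rfl hn]

/-- Once K|s - u| exceeds π the distance is no longer the arc length, but the diameter of the sphere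
bounds it. -/
theorem dist_le (h : FoldedArc A i j k l B C σ γ K t₁ t₂ L₁ L₂ L₃) (s u : ℝ) :
    dist (σ s) (σ u) ≤ K * |s - u| := by
  rcases le_total (K * |s - u|) Real.pi with h1 | h1
  · exact (h.dist_eq s u h1).le
  · exact (Sph.dist_le_pi _ _).trans h1

theorem dist_map_le_of_le (h : FoldedArc A i j k l B C σ γ K t₁ t₂ L₁ L₂ L₃) {s u : ℝ} (hs : 0 ≤ s)
    (hsu : s ≤ u) (hu : u ≤ 1) : dist (γ s) (γ u) ≤ K * (u - s) := by
  have key : ∀ {L : EuclideanSpace ℝ (Fin 3) →ₗᵢ[ℝ] EuclideanSpace ℝ (Fin 4)} {a b : ℝ},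
      (∀ t ∈ Icc a b, L (σ t).vec = (γ t).vec) → ∀ {s u : ℝ}, a ≤ s → s ≤ u → u ≤ b →
        dist (γ s) (γ u) ≤ K * (u - s) := by
    intro L a b hL s u hs hsu hu
    rw [← Sph.dist_eq_of_map L (hL s ⟨hs, hsu.trans hu⟩) (hL u ⟨hs.trans hsu, hu⟩)]
    refine (h.dist_le s u).trans ?_
    rw [abs_sub_comm, abs_of_nonneg (sub_nonneg.2 hsu)]
  have h12 := h.t₁_lt_t₂.le
  have key₂ : ∀ {s u : ℝ}, t₁ ≤ s → s ≤ u → u ≤ 1 → dist (γ s) (γ u) ≤ K * (u - s) := by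
    intro s u hs hsu hu
    rcases le_total u t₂ with h1 | h1
    · exact key h.map₂ hs hsu h1
    rcases le_total t₂ s with h2 | h2
    · exact key h.map₃ h2 hsu hu
    · linarith [dist_triangle (γ s) (γ t₂) (γ u), key h.map₂ hs h2 le_rfl,
        key h.map₃ le_rfl h1 hu]
  rcases le_total u t₁ with h1 | h1
  · exact key h.map₁ hs hsu h1
  rcases le_total t₁ s with h2 | h2
  · exact key₂ h2 hsu hu
  · linarith [dist_triangle (γ s) (γ t₁) (γ u), key h.map₁ hs h2 le_rfl, key₂ le_rfl h1 hu]

theorem lipschitzOnWith (h : FoldedArc A i j k l B C σ γ K t₁ t₂ L₁ L₂ L₃) :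
    LipschitzOnWith K.toNNReal γ (Icc 0 1) := by
  refine LipschitzOnWith.of_dist_le_mul fun s hs u hu => ?_
  rw [Real.coe_toNNReal _ h.K_pos.le, Real.dist_eq]
  rcases le_total s u with h1 | h1
  · rw [abs_sub_comm, abs_of_nonneg (sub_nonneg.2 h1)]
    exact h.dist_map_le_of_le hs.1 h1 hu.2
  · rw [dist_comm, abs_of_nonneg (sub_nonneg.2 h1)]
    exact h.dist_map_le_of_le hu.1 h1 hs.2

theorem eVariationOn_le (h : FoldedArc A i j k l B C σ γ K t₁ t₂ L₁ L₂ L₃) {s u : ℝ} (hs : 0 ≤ s)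
    (hsu : s ≤ u) (hu : u ≤ 1) : eVariationOn γ (Icc s u) ≤ ENNReal.ofReal (K * (u - s)) := by
  have h1 := h.lipschitzOnWith.comp_eVariationOn_le (g := id) (s := Icc s u)
    (fun x hx => ⟨hs.trans hx.1, hx.2.trans hu⟩)
  refine h1.trans ?_
  rw [ENNReal.ofReal_mul h.K_pos.le]
  refine mul_le_mul_right ?_ _
  have := (monotoneOn_id (s := Icc s u)).eVariationOn_eq (left_mem_Icc.2 hsu) (right_mem_Icc.2 hsu)
  rw [inter_self] at this
  exact this.le

end FoldedArc

/-! ### Folded arcs are simple geodesic loops. -/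

namespace FoldedArc

variable {A : Fin 4 → Sph 3} {i j k l : Fin 4} {B C : Fin 4 → Sph 2} {σ : ℝ → Sph 2}
    {γ : ℝ → Sph 3} {K t₁ t₂ : ℝ}
    {L₁ L₂ L₃ : EuclideanSpace ℝ (Fin 3) →ₗᵢ[ℝ] EuclideanSpace ℝ (Fin 4)}

theorem le_intrinsicEDist_of_map (h : FoldedArc A i j k l B C σ γ K t₁ t₂ L₁ L₂ L₃)
    {L : EuclideanSpace ℝ (Fin 3) →ₗᵢ[ℝ] EuclideanSpace ℝ (Fin 4)} {s u : ℝ} (hsu : s ≤ u)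
    (hs : L (σ s).vec = (γ s).vec) (hu : L (σ u).vec = (γ u).vec) (hK : K * (u - s) ≤ Real.pi) :
    ENNReal.ofReal (K * (u - s)) ≤ intrinsicEDist (surface A) (γ s) (γ u) := by
  refine le_trans ?_ (dist_le_intrinsicEDist _ _ _)
  have h1 := h.dist_eq s u
  rw [abs_sub_comm, abs_of_nonneg (sub_nonneg.2 hsu)] at h1
  rw [← Sph.dist_eq_of_map L hs hu, h1 hK]

theorem exists_bound_of_interior (h : FoldedArc A i j k l B C σ γ K t₁ t₂ L₁ L₂ L₃)
    {L : EuclideanSpace ℝ (Fin 3) →ₗᵢ[ℝ] EuclideanSpace ℝ (Fin 4)} {T a b : ℝ} (haT : a < T)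
    (hTb : T < b) (hL : ∀ t ∈ Icc a b, L (σ t).vec = (γ t).vec) :
    ∃ ε > 0, ∀ s ∈ Ioo (T - ε) (T + ε), ∀ u ∈ Ioo (T - ε) (T + ε), s ≤ u →
      ENNReal.ofReal (K * (u - s)) ≤ intrinsicEDist (surface A) (γ s) (γ u) := by
  have hK := h.K_pos
  obtain ⟨ε, hε, h1⟩ : ∃ ε > 0, ε ≤ T - a ∧ ε ≤ b - T ∧ ε ≤ Real.pi / (2 * K) :=
    ⟨min (min (T - a) (b - T)) (Real.pi / (2 * K)),
      lt_min (lt_min (by linarith) (by linarith)) (div_pos Real.pi_pos (by linarith)),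
      (min_le_left _ _).trans (min_le_left _ _), (min_le_left _ _).trans (min_le_right _ _),
      min_le_right _ _⟩
  rw [le_div_iff₀ (by linarith)] at h1
  refine ⟨ε, hε, fun s hs u hu hsu => h.le_intrinsicEDist_of_map hsu (hL s ?_) (hL u ?_) ?_⟩
  · exact ⟨by linarith [hs.1], by linarith [hs.2]⟩
  · exact ⟨by linarith [hu.1], by linarith [hu.2]⟩
  · nlinarith [hs.1, hu.2]

theorem exists_bound_of_crossing (h : FoldedArc A i j k l B C σ γ K t₁ t₂ L₁ L₂ L₃)
    (hA : IsTetrahedron A) {p q r r' : Fin 4} (hn : [p, q, r, r'].Nodup)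
    {L L' : EuclideanSpace ℝ (Fin 3) →ₗᵢ[ℝ] EuclideanSpace ℝ (Fin 4)} {T a b : ℝ} (ha : 0 ≤ a)
    (haT : a < T) (hTb : T < b) (hb : b ≤ 1)
    (hL : ∀ t ∈ Icc a T, L (σ t).vec = (γ t).vec) (hL' : ∀ t ∈ Icc T b, L' (σ t).vec = (γ t).vec)
    (hLr : L (B r).vec = (A r).vec) (hLr' : L (B r').vec = (A r').vec)
    (hLr₂ : L' (B r).vec = (A r).vec) (hLr₂' : L' (B r').vec = (A r').vec)
    (hp : ∀ t ∈ Icc a T, γ t ∈ face A p) (hq : ∀ t ∈ Icc T b, γ t ∈ face A q)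
    (hT : γ T ∉ face A r) (hT' : γ T ∉ face A r') :
    ∃ ε > 0, ∀ s ∈ Ioo (T - ε) (T + ε), ∀ u ∈ Ioo (T - ε) (T + ε), s ≤ u →
      ENNReal.ofReal (K * (u - s)) ≤ intrinsicEDist (surface A) (γ s) (γ u) := by
  have hK := h.K_pos
  obtain ⟨δ, hδ, hball⟩ := Metric.isOpen_iff.1
    ((hA.isClosed_face r).union (hA.isClosed_face r')).isOpen_compl (γ T)
    (by rintro (h | h) <;> contradiction)
  -- The bound π / (2K) keeps K(u - s) below π. With δ / (3K), a point z at distance at least δ from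
  -- γ T is at least 2Kε away from γ s, which exceeds K(u - s).
  obtain ⟨ε, hε, h1⟩ : ∃ ε > 0, ε ≤ T - a ∧ ε ≤ b - T ∧ ε ≤ Real.pi / (2 * K) ∧ ε ≤ δ / (3 * K) :=
    ⟨min (min (T - a) (b - T)) (min (Real.pi / (2 * K)) (δ / (3 * K))),
      lt_min (lt_min (by linarith) (by linarith))
        (lt_min (div_pos Real.pi_pos (by linarith)) (div_pos hδ (by linarith))),
      (min_le_left _ _).trans (min_le_left _ _), (min_le_left _ _).trans (min_le_right _ _),
      (min_le_right _ _).trans (min_le_left _ _), (min_le_right _ _).trans (min_le_right _ _)⟩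
  rw [le_div_iff₀ (by linarith), le_div_iff₀ (by linarith)] at h1
  obtain ⟨h1, h2, h3, h4⟩ := h1
  refine ⟨ε, hε, fun s hs u hu hsu => ?_⟩
  have hsa : a ≤ s := by linarith [hs.1]
  have hub : u ≤ b := by linarith [hu.2]
  have hKπ : K * (u - s) ≤ Real.pi := by nlinarith [hs.1, hu.2]
  rcases le_total u T with hu' | hu'
  · exact h.le_intrinsicEDist_of_map hsu (hL s ⟨hsa, hsu.trans hu'⟩) (hL u ⟨hsa.trans hsu, hu'⟩)
      hKπ
  rcases le_total T s with hs' | hs'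
  · exact h.le_intrinsicEDist_of_map hsu (hL' s ⟨hs', hsu.trans hub⟩) (hL' u ⟨hs'.trans hsu, hub⟩)
      hKπ
  have hd := h.dist_eq s u
  rw [abs_sub_comm, abs_of_nonneg (sub_nonneg.2 hsu)] at hd
  rw [← hd hKπ]
  refine hA.dist_le_intrinsicEDist_of_adjacent hn hLr hLr' (hL s ⟨hsa, hs'⟩) hLr₂ hLr₂'
    (hL' u ⟨hu', hub⟩) (hp s ⟨hsa, hs'⟩) (hq u ⟨hu', hub⟩) fun z hz => ?_
  rw [hd hKπ]
  have hz' : δ ≤ dist z (γ T) := by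
    by_contra! hlt
    exact hball hlt hz
  have hsT := h.dist_map_le_of_le (ha.trans hsa) hs' (by linarith)
  have := dist_triangle z (γ s) (γ T)
  rw [dist_comm z (γ s)] at this
  nlinarith [hs.1, hu.2]

theorem exists_bound (h : FoldedArc A i j k l B C σ γ K t₁ t₂ L₁ L₂ L₃)
    (hA : IsTetrahedron A) {t : ℝ} (ht : t ∈ Ioo (0 : ℝ) 1) :
    ∃ ε > 0, ∀ s ∈ Ioo (t - ε) (t + ε), ∀ u ∈ Ioo (t - ε) (t + ε), s ≤ u →
      ENNReal.ofReal (K * (u - s)) ≤ intrinsicEDist (surface A) (γ s) (γ u) := by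
  have h1 := h.t₁_pos
  have h12 := h.t₁_lt_t₂
  have h2 := h.t₂_lt_one
  have hn := h.nodup
  simp only [List.nodup_cons, List.mem_cons, List.not_mem_nil, or_false, not_or] at hn
  obtain ⟨⟨hij, hik, hil⟩, ⟨hjk, hjl⟩, hkl, -⟩ := hn
  rcases lt_trichotomy t t₁ with h3 | rfl | h3
  · exact h.exists_bound_of_interior ht.1 h3 h.map₁
  · obtain ⟨w, -, hw, -, -, -, -, -, hj, hl, -⟩ := h.weights t ⟨ht.1.le, ht.2.le⟩
    refine h.exists_bound_of_crossing hA (p := k) (q := i) (r := j) (r' := l) ?_ le_rfl h1 h12 h2.le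
      h.map₁ h.map₂ (h.L₁_B j (Ne.symm hij) hjk) (h.L₁_B l (Ne.symm hil) (Ne.symm hkl))
      (h.L₂_B j (Ne.symm hij)) (h.L₂_B l (Ne.symm hil)) (fun s => h.mem_face₁)
      (fun s => h.mem_face₂) (hA.notMem_face hw (hj ht.1 ht.2).ne')
      (hA.notMem_face hw (hl ht.1 h12).ne')
    simp only [List.nodup_cons, List.mem_cons, List.not_mem_nil, or_false, not_or]
    tauto
  rcases lt_trichotomy t t₂ with h4 | rfl | h4
  · exact h.exists_bound_of_interior h3 h4 h.map₂
  · obtain ⟨w, -, hw, -, -, -, -, -, hj, -, hk⟩ := h.weights t ⟨ht.1.le, ht.2.le⟩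
    refine h.exists_bound_of_crossing hA (p := i) (q := l) (r := j) (r' := k) ?_ h1.le h12 h2 le_rfl
      h.map₂ h.map₃ (h.L₂_B j (Ne.symm hij)) (h.L₂_B k (Ne.symm hik))
      (h.L₃_B j (Ne.symm hij) hjl) (h.L₃_B k (Ne.symm hik) hkl) (fun s => h.mem_face₂)
      (fun s => h.mem_face₃) (hA.notMem_face hw (hj ht.1 ht.2).ne')
      (hA.notMem_face hw (hk h12 ht.2).ne')
    simp only [List.nodup_cons, List.mem_cons, List.not_mem_nil, or_false, not_or]
    tauto
  · exact h.exists_bound_of_interior h4 ht.2 h.map₃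

theorem map_zero (h : FoldedArc A i j k l B C σ γ K t₁ t₂ L₁ L₂ L₃) : γ 0 = A i :=
  Sph.ext (by rw [← h.map₁ 0 ⟨le_rfl, h.t₁_pos.le⟩, h.start, h.L₁_C])

theorem map_one (h : FoldedArc A i j k l B C σ γ K t₁ t₂ L₁ L₂ L₃) : γ 1 = A i :=
  Sph.ext (by rw [← h.map₃ 1 ⟨h.t₂_lt_one.le, le_rfl⟩, h.finish, h.L₃_C])

theorem mapsTo (h : FoldedArc A i j k l B C σ γ K t₁ t₂ L₁ L₂ L₃) :
    MapsTo γ (Icc 0 1) (surface A) := fun _ ht =>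
  let ⟨m, _, hm⟩ := h.exists_mem_face ht
  mem_iUnion.2 ⟨m, hm⟩

theorem map_ne (h : FoldedArc A i j k l B C σ γ K t₁ t₂ L₁ L₂ L₃) (hA : IsTetrahedron A) {t : ℝ}
    (ht : t ∈ Ioo (0 : ℝ) 1) (m : Fin 4) : γ t ≠ A m := by
  intro h0
  have hn := h.nodup
  simp only [List.nodup_cons, List.mem_cons, List.not_mem_nil, or_false, not_or] at hn
  obtain ⟨w, -, hw, -, -, -, -, -, hj, hl, hk⟩ := h.weights t ⟨ht.1.le, ht.2.le⟩
  -- A vertex has one nonzero weight, while at interior times the weight of j and that of l or k are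
  -- both positive.
  have hw' : w = Pi.single m 1 := hA.weights_unique (by
    rw [← hw, h0, Finset.sum_eq_single m (fun n _ hn => by simp [hn]) (by simp)]
    simp)
  have hpos : ∀ {n}, 0 < w n → n = m := fun {n} hn => by
    by_contra hne
    rw [hw', Pi.single_eq_of_ne hne] at hn
    exact lt_irrefl _ hn
  have hj' := hpos (hj ht.1 ht.2)
  rcases lt_or_ge t t₂ with h2 | h2
  · exact hn.2.1.2 (hj'.trans (hpos (hl ht.1 h2)).symm)
  · exact hn.2.1.1 (hj'.trans (hpos (hk (h.t₁_lt_t₂.trans_le h2) ht.2)).symm)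

theorem eq_of_map_eq (h : FoldedArc A i j k l B C σ γ K t₁ t₂ L₁ L₂ L₃)
    {L : EuclideanSpace ℝ (Fin 3) →ₗᵢ[ℝ] EuclideanSpace ℝ (Fin 4)} {s u : ℝ}
    (hs : s ∈ Icc (0 : ℝ) 1) (hu : u ∈ Icc (0 : ℝ) 1)
    (hLs : L (σ s).vec = (γ s).vec) (hLu : L (σ u).vec = (γ u).vec) (hsu : γ s = γ u) : s = u :=
  h.injOn hs hu (Sph.ext (L.injective (by rw [hLs, hLu, hsu])))

theorem injOn_Ico (h : FoldedArc A i j k l B C σ γ K t₁ t₂ L₁ L₂ L₃) (hA : IsTetrahedron A) :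
    InjOn γ (Ico 0 1) := by
  have key : ∀ s ∈ Ico (0 : ℝ) 1, ∀ u ∈ Ico (0 : ℝ) 1, s ≤ u → γ s = γ u → s = u := by
    intro s hs u hu hsu hγ
    have hs' : s ∈ Icc (0 : ℝ) 1 := ⟨hs.1, hs.2.le⟩
    have hu' : u ∈ Icc (0 : ℝ) 1 := ⟨hu.1, hu.2.le⟩
    rcases hsu.eq_or_lt with rfl | hlt
    · rfl
    rcases hs.1.eq_or_lt with rfl | hs0
    · exact absurd (hγ.symm.trans h.map_zero) (h.map_ne hA ⟨hlt, hu.2⟩ i)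
    obtain ⟨v, -, hv, hv1, hv2, -⟩ := h.weights s hs'
    obtain ⟨w, -, hw, -, -, -, -, hw1, -, -, hw2⟩ := h.weights u hu'
    have hvw : v = w := hA.weights_unique (by rw [← hv, ← hw, hγ])
    subst hvw
    -- Within one piece the folding is injective. Otherwise a weight tells the points apart: that of
    -- k vanishes up to t₁ and is positive after it, that of i vanishes between t₁ and t₂ and is
    -- positive after t₂.
    rcases le_or_gt u t₁ with h1 | h1
    · exact h.eq_of_map_eq hs' hu' (h.map₁ s ⟨hs.1, hsu.trans h1⟩) (h.map₁ u ⟨hu.1, h1⟩) hγ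
    rcases le_or_gt s t₁ with h2 | h2
    · exact absurd (hv1 h2) (hw2 h1 hu.2).ne'
    rcases le_or_gt u t₂ with h3 | h3
    · exact h.eq_of_map_eq hs' hu' (h.map₂ s ⟨h2.le, hsu.trans h3⟩) (h.map₂ u ⟨h1.le, h3⟩) hγ
    rcases le_or_gt s t₂ with h4 | h4
    · exact absurd (hv2 h2.le h4) (hw1 h3).ne'
    · exact h.eq_of_map_eq hs' hu' (h.map₃ s ⟨h4.le, hs.2.le⟩) (h.map₃ u ⟨h3.le, hu.2.le⟩) hγ
  intro s hs u hu hγ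
  rcases le_total s u with h1 | h1
  · exact key s hs u hu h1 hγ
  · exact (key u hu s hs h1 hγ.symm).symm

theorem isSimpleGeodesicLoop (h : FoldedArc A i j k l B C σ γ K t₁ t₂ L₁ L₂ L₃)
    (hA : IsTetrahedron A) : IsSimpleGeodesicLoop A i γ where
  continuousOn := h.lipschitzOnWith.continuousOn
  mapsTo := h.mapsTo
  start := h.map_zero
  finish := h.map_one
  simple := h.injOn_Ico hA
  avoids t ht m hm h0 := by
    have hinj : A i ≠ A m := fun h1 => hm
      (LinearIndependent.injective hA (congrArg Sph.vec h1)).symm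
    rcases ht.1.eq_or_lt with rfl | h1
    · exact hinj (h.map_zero.symm.trans h0)
    rcases ht.2.eq_or_lt with rfl | h2
    · exact hinj (h.map_one.symm.trans h0)
    · exact h.map_ne hA ⟨h1, h2⟩ m h0
  geodesic := by
    refine ⟨h.lipschitzOnWith.continuousOn.mono Ioo_subset_Icc_self,
      h.mapsTo.mono_left Ioo_subset_Icc_self, fun t ht => ?_⟩
    obtain ⟨ε, hε, hb⟩ := h.exists_bound hA ht
    refine ⟨ε, hε, fun s hs u hu hsu => le_antisymm ?_ ?_⟩
    · exact (h.eVariationOn_le hs.1.1.le hsu hu.1.2.le).trans (hb s hs.2 u hu.2 hsu)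
    · have hsub : Icc s u ⊆ Icc 0 1 := Icc_subset_Icc hs.1.1.le hu.1.2.le
      exact intrinsicEDist_le hsu (h.lipschitzOnWith.continuousOn.mono hsub)
        (h.mapsTo.mono_left hsub)

theorem developsTo (h : FoldedArc A i j k l B C σ γ K t₁ t₂ L₁ L₂ L₃) :
    DevelopsTo A i k l B C γ σ :=
  ⟨h.start, h.finish, t₁, t₂, h.t₁_pos, h.t₁_lt_t₂, h.t₂_lt_one,
    fun t ht => ⟨h.mem_face₁ ht, Sph.dist_eq_of_map L₁ (h.map₁ t ht) h.L₁_C,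
      fun m hm hm' => Sph.dist_eq_of_map L₁ (h.map₁ t ht) (h.L₁_B m hm hm')⟩,
    fun t ht => ⟨h.mem_face₂ ht,
      fun m hm => Sph.dist_eq_of_map L₂ (h.map₂ t ht) (h.L₂_B m hm)⟩,
    fun t ht => ⟨h.mem_face₃ ht, Sph.dist_eq_of_map L₃ (h.map₃ t ht) h.L₃_C,
      fun m hm hm' => Sph.dist_eq_of_map L₃ (h.map₃ t ht) (h.L₃_B m hm hm')⟩⟩

end FoldedArc

/-! ### Folding the great circle arc back onto the tetrahedron. -/

/-- The image of a point of the sphere under a linear isometry. -/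
noncomputable def Sph.map {n m : ℕ}
    (L : EuclideanSpace ℝ (Fin (n + 1)) →ₗᵢ[ℝ] EuclideanSpace ℝ (Fin (m + 1))) (x : Sph n) :
    Sph m :=
  ⟨L x.vec, by rw [L.norm_map, x.norm_vec]⟩

theorem IsTetrahedron.exists_linearIsometry {A : Fin 4 → Sph 3} (hA : IsTetrahedron A)
    {p q r : Fin 4} (hpq : p ≠ q) (hpr : p ≠ r) (hqr : q ≠ r) {x y z : Sph 2}
    (hxy : dist x y = dist (A p) (A q)) (hxz : dist x z = dist (A p) (A r))
    (hyz : dist y z = dist (A q) (A r)) :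
    ∃ L : EuclideanSpace ℝ (Fin 3) →ₗᵢ[ℝ] EuclideanSpace ℝ (Fin 4),
      L x.vec = (A p).vec ∧ L y.vec = (A q).vec ∧ L z.vec = (A r).vec := by
  have hinj : Function.Injective ![p, q, r] := by
    intro a b
    fin_cases a <;> fin_cases b <;> simp [hpq, hpr, hqr, hpq.symm, hpr.symm, hqr.symm]
  have hdist : ∀ a b : Fin 3, dist (![x, y, z] a) (![x, y, z] b) =
      dist (A (![p, q, r] a)) (A (![p, q, r] b)) := by
    intro a b
    fin_cases a <;> fin_cases b <;>
      simp [hxy, hxz, hyz, dist_comm y x, dist_comm z x, dist_comm z y, dist_comm (A q) (A p),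
        dist_comm (A r) (A p), dist_comm (A r) (A q)]
  obtain ⟨L, hL⟩ := exists_linearIsometry_of_inner_eq (u := fun a => (![x, y, z] a).vec)
    (LinearIndependent.comp hA _ hinj) (fun a b => (Sph.dist_eq_iff _ _ _ _).1 (hdist a b))
  exact ⟨L, hL 0, hL 1, hL 2⟩

/-- A point of an arc of a great circle is a nonnegative combination of the end points. -/
theorem exists_arc_combination {V : Type*} [AddCommGroup V] [Module ℝ V] (E f : V) {u v α : ℝ}
    (huv : v < u) (hπ : u - v < Real.pi) (hα : α ∈ Icc v u) :
    ∃ p q : ℝ, 0 ≤ p ∧ 0 ≤ q ∧ (v < α → 0 < p) ∧ (α < u → 0 < q) ∧ (α = v → p = 0) ∧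
      Real.cos α • E + Real.sin α • f =
        p • (Real.cos u • E + Real.sin u • f) + q • (Real.cos v • E + Real.sin v • f) := by
  have hs : 0 < Real.sin (u - v) := Real.sin_pos_of_pos_of_lt_pi (by linarith) hπ
  refine ⟨Real.sin (α - v) / Real.sin (u - v), Real.sin (u - α) / Real.sin (u - v),
    div_nonneg (Real.sin_nonneg_of_nonneg_of_le_pi (by linarith [hα.1]) (by linarith [hα.2])) hs.le,
    div_nonneg (Real.sin_nonneg_of_nonneg_of_le_pi (by linarith [hα.2]) (by linarith [hα.1])) hs.le,
    fun h => div_pos (Real.sin_pos_of_pos_of_lt_pi (by linarith) (by linarith [hα.2])) hs,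
    fun h => div_pos (Real.sin_pos_of_pos_of_lt_pi (by linarith) (by linarith [hα.1])) hs,
    fun h => by rw [h, sub_self, Real.sin_zero, zero_div], ?_⟩
  have hne := hs.ne'
  match_scalars <;> field_simp <;> simp only [Real.sin_sub] <;> ring

theorem Ortho3.inner_circle {V : Type*} [NormedAddCommGroup V] [InnerProductSpace ℝ V]
    {O E f : V} (ho : Ortho3 O E f) (α β : ℝ) :
    inner ℝ (Real.cos α • E + Real.sin α • f) (Real.cos β • E + Real.sin β • f) =
      Real.cos (α - β) := by
  have := ho.inner_eq 0 (Real.cos α) (Real.sin α) 0 (Real.cos β) (Real.sin β)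
  simp only [zero_smul, zero_add] at this
  rw [this, Real.cos_sub]
  ring

/-- An arc of a great circle, of length `2 * τ`, run through with constant speed. -/
theorem Ortho3.exists_path {O E f : EuclideanSpace ℝ (Fin 3)} (ho : Ortho3 O E f) {τ : ℝ}
    (hτ : τ ∈ Ioo (Real.pi / 2) Real.pi) : ∃ σ : ℝ → Sph 2,
      (∀ t, (σ t).vec = Real.cos (τ * (1 - 2 * t)) • E + Real.sin (τ * (1 - 2 * t)) • f) ∧
      (∀ s u, 2 * τ * |s - u| ≤ Real.pi → dist (σ s) (σ u) = 2 * τ * |s - u|) ∧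
      InjOn σ (Icc 0 1) ∧ ∀ t, inner ℝ O (σ t).vec = (0 : ℝ) := by
  have hτ0 : 0 < τ := by linarith [hτ.1, Real.pi_pos]
  have hex : ∀ t : ℝ, ∃ x : Sph 2, x.vec =
      Real.cos (τ * (1 - 2 * t)) • E + Real.sin (τ * (1 - 2 * t)) • f := fun t => ⟨⟨_, by
    rw [← sq_eq_sq₀ (norm_nonneg _) zero_le_one, ← real_inner_self_eq_norm_sq, ho.inner_circle,
      sub_self, Real.cos_zero, one_pow]⟩, rfl⟩
  choose σ hσ using hex
  refine ⟨σ, hσ, fun s u hsu => ?_, fun s hs u hu hsu => ?_, fun t => ?_⟩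
  · refine Real.injOn_cos ⟨dist_nonneg, Sph.dist_le_pi _ _⟩ ⟨by positivity, hsu⟩ ?_
    have h1 : |τ * (1 - 2 * s) - τ * (1 - 2 * u)| = 2 * τ * |s - u| := by
      rw [show τ * (1 - 2 * s) - τ * (1 - 2 * u) = -(2 * τ * (s - u)) by ring, abs_neg, abs_mul,
        abs_of_pos (by linarith : 0 < 2 * τ)]
    rw [Sph.cos_dist, hσ, hσ, ho.inner_circle, ← Real.cos_abs, h1]
  · have h0 : Real.cos (τ * (1 - 2 * s) - τ * (1 - 2 * u)) = 1 := by
      rw [← ho.inner_circle, ← hσ, ← hσ, hsu, Sph.inner_self]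
    -- The arc has length 2τ < 2π, so it does not close up.
    rw [Real.cos_eq_one_iff_of_lt_of_lt (by nlinarith [hs.1, hs.2, hu.1, hu.2, hτ.2])
      (by nlinarith [hs.1, hs.2, hu.1, hu.2, hτ.2])] at h0
    nlinarith
  · rw [hσ, inner_add_right, real_inner_smul_right, real_inner_smul_right, ho.be, ho.bf]
    ring

/-- The barycentric weights of the points of an arc of a great circle, with respect to the
triangles `c b y`, `b x y` and `c' b x` which it crosses successively. -/
theorem exists_arc_weights {V : Type*} [AddCommGroup V] [Module ℝ V] {E f b x y c c' : V}
    {τ τ₁ τ₂ m n m' n' t₁ t₂ : ℝ} (hτ : τ ∈ Ioo (Real.pi / 2) Real.pi)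
    (hτ₁ : τ₁ ∈ Ioo 0 (Real.pi / 2)) (hτ₂ : τ₂ ∈ Ioo 0 (Real.pi / 2))
    (hm : 0 < m) (hn : 0 < n) (hm' : 0 < m') (hn' : 0 < n')
    (hc : Real.cos τ • E + Real.sin τ • f = c) (hc' : Real.cos (-τ) • E + Real.sin (-τ) • f = c')
    (h₁ : Real.cos τ₁ • E + Real.sin τ₁ • f = m • b + n • y)
    (h₂ : Real.cos (-τ₂) • E + Real.sin (-τ₂) • f = m' • b + n' • x)
    (ht₁ : τ * (1 - 2 * t₁) = τ₁) (ht₂ : τ * (1 - 2 * t₂) = -τ₂) (ht₁₂ : t₁ < t₂)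
    {t : ℝ} (ht : t ∈ Icc (0 : ℝ) 1) :
    ∃ wi wj wk wl : ℝ, (0 ≤ wi ∧ 0 ≤ wj ∧ 0 ≤ wk ∧ 0 ≤ wl) ∧ ((t ≤ t₁ → wk = 0) ∧
      (t₁ ≤ t → t ≤ t₂ → wi = 0) ∧ (t₂ ≤ t → wl = 0) ∧ (t < t₁ → 0 < wi) ∧ (t₂ < t → 0 < wi) ∧
      (0 < t → t < 1 → 0 < wj) ∧ (0 < t → t < t₂ → 0 < wl) ∧ (t₁ < t → t < 1 → 0 < wk)) ∧
      (t ≤ t₁ ∧ Real.cos (τ * (1 - 2 * t)) • E + Real.sin (τ * (1 - 2 * t)) • f =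
          wi • c + wj • b + wk • x + wl • y ∨
        (t₁ ≤ t ∧ t ≤ t₂) ∧ Real.cos (τ * (1 - 2 * t)) • E + Real.sin (τ * (1 - 2 * t)) • f =
          wj • b + wk • x + wl • y ∨
        t₂ ≤ t ∧ Real.cos (τ * (1 - 2 * t)) • E + Real.sin (τ * (1 - 2 * t)) • f =
          wi • c' + wj • b + wk • x + wl • y) := by
  have hτ0 : 0 < τ := by linarith [Real.pi_pos, hτ.1]
  have hmono : ∀ {s u : ℝ}, s < u → τ * (1 - 2 * u) < τ * (1 - 2 * s) := fun {s u} hsu => by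
    nlinarith
  have hmono' : ∀ {s u : ℝ}, s ≤ u → τ * (1 - 2 * u) ≤ τ * (1 - 2 * s) := fun {s u} hsu => by
    nlinarith
  have ha0 : ∀ {t : ℝ}, 0 < t → τ * (1 - 2 * t) < τ := fun {t} ht => by nlinarith
  have ha1 : ∀ {t : ℝ}, t < 1 → -τ < τ * (1 - 2 * t) := fun {t} ht => by nlinarith
  rcases le_or_gt t t₁ with hc₁ | hc₁
  -- The angle τ(1 - 2t) decreases from τ to -τ. Each of the three ranges, separated by τ₁ and -τ₂,
  -- is shorter than π, so the weights follow from those of its two end points.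
  · obtain ⟨p, q, hp, hq, hp', hq', hp0, hpq⟩ := exists_arc_combination E f (v := τ₁) (u := τ)
      (by linarith [hτ₁.2, hτ.1]) (by linarith [hτ₁.1, hτ.2])
      ⟨ht₁ ▸ hmono' hc₁, by nlinarith [ht.1]⟩
    refine ⟨p, q * m, 0, q * n, ⟨hp, mul_nonneg hq hm.le, le_rfl, mul_nonneg hq hn.le⟩,
      ⟨fun _ => rfl, fun h3 _ => hp0 (by rw [le_antisymm hc₁ h3, ht₁]),
      fun h3 => by linarith, fun h3 => hp' (ht₁ ▸ hmono h3), fun h3 => by linarith,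
      fun h3 _ => mul_pos (hq' (ha0 h3)) hm, fun h3 _ => mul_pos (hq' (ha0 h3)) hn,
      fun h3 => by linarith⟩, Or.inl ⟨hc₁, ?_⟩⟩
    rw [hpq, hc, h₁]
    module
  rcases le_or_gt t t₂ with hc₂ | hc₂
  · obtain ⟨p, q, hp, hq, hp', hq', hp0, hpq⟩ := exists_arc_combination E f (v := -τ₂) (u := τ₁)
      (by linarith [hτ₁.1, hτ₂.1]) (by linarith [hτ₁.2, hτ₂.2])
      ⟨ht₂ ▸ hmono' hc₂, ht₁ ▸ hmono' hc₁.le⟩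
    have hq₁ := hq' (ht₁ ▸ hmono hc₁)
    have hj0 : 0 < p * m + q * m' := by positivity
    refine ⟨0, p * m + q * m', q * n', p * n,
      ⟨le_rfl, hj0.le, mul_nonneg hq hn'.le, mul_nonneg hp hn.le⟩,
      ⟨fun h3 => by linarith, fun _ _ => rfl,
      fun h3 => by rw [hp0 (by rw [le_antisymm hc₂ h3, ht₂]), zero_mul],
      fun h3 => by linarith, fun h3 => by linarith, fun _ _ => hj0,
      fun _ h3 => mul_pos (hp' (ht₂ ▸ hmono h3)) hn, fun _ _ => mul_pos hq₁ hn'⟩,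
      Or.inr (Or.inl ⟨⟨hc₁.le, hc₂⟩, ?_⟩)⟩
    rw [hpq, h₁, h₂]
    module
  · obtain ⟨p, q, hp, hq, hp', hq', -, hpq⟩ := exists_arc_combination E f (v := -τ) (u := -τ₂)
      (by linarith [hτ₂.2, hτ.1]) (by linarith [hτ₂.1, hτ.2])
      ⟨by nlinarith [ht.2], ht₂ ▸ hmono' hc₂.le⟩
    have hq₁ := hq' (ht₂ ▸ hmono hc₂)
    refine ⟨q, p * m', p * n', 0, ⟨hq, mul_nonneg hp hm'.le, mul_nonneg hp hn'.le, le_rfl⟩,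
      ⟨fun h3 => by linarith, fun _ h3 => by linarith, fun _ => rfl,
      fun h3 => by linarith, fun _ => hq₁, fun _ h3 => mul_pos (hp' (ha1 h3)) hm',
      fun _ h3 => by linarith, fun _ h3 => mul_pos (hp' (ha1 h3)) hn'⟩,
      Or.inr (Or.inr ⟨hc₂.le, ?_⟩)⟩
    rw [hpq, h₂, hc']
    module

namespace IsUnfolding

variable {A : Fin 4 → Sph 3} {i j k l : Fin 4} {B C : Fin 4 → Sph 2}

theorem exists_arc (h : IsUnfolding A i B C) (hA : IsTetrahedron A)
    (hangle : ∀ i j k, i ≠ j → j ≠ k → i ≠ k → Real.pi / 2 < sphAngle (A i) (A j) (A k))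
    (hedge : ∀ i j, i ≠ j → Real.pi / 2 < dist (A i) (A j)) (hn : [i, j, k, l].Nodup) :
    ∃ O E f, Ortho3 O E f ∧ 0 < (inner ℝ O (B j).vec : ℝ) ∧ inner ℝ O (B k).vec < (0 : ℝ) ∧
      inner ℝ O (B l).vec < (0 : ℝ) ∧
      ∃ τ ∈ Ioo (Real.pi / 2) Real.pi, (C k).vec = Real.cos τ • E + Real.sin τ • f ∧
        (C l).vec = Real.cos τ • E - Real.sin τ • f ∧
        (∃ τ₁ ∈ Ioo 0 (Real.pi / 2), ∃ m n : ℝ, 0 < m ∧ 0 < n ∧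
          Real.cos τ₁ • E + Real.sin τ₁ • f = m • (B j).vec + n • (B l).vec) ∧
        (∃ τ₂ ∈ Ioo 0 (Real.pi / 2), ∃ m n : ℝ, 0 < m ∧ 0 < n ∧
          Real.cos τ₂ • E - Real.sin τ₂ • f = m • (B j).vec + n • (B k).vec) := by
  have hn₁ : [i, j, l, k].Nodup := by clear * - hn; revert i j k l; decide
  have hn₂ : [l, j, k, i].Nodup := by clear * - hn; revert i j k l; decide
  have hn₃ : [k, j, i, l].Nodup := by clear * - hn; revert i j k l; decide
  have hn₄ : [i, k, j, l].Nodup := by clear * - hn; revert i j k l; decide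
  have hn₅ : [i, l, j, k].Nodup := by clear * - hn; revert i j k l; decide
  have hne := hn
  simp only [List.nodup_cons, List.mem_cons, List.not_mem_nil, or_false, not_or] at hne
  obtain ⟨⟨hij, hik, hil⟩, ⟨hjk, hjl⟩, hkl, -⟩ := hne
  have hd : dist (A i) (A j) ∈ Ioo (Real.pi / 2) Real.pi := ⟨hedge _ _ hij, hA.dist_lt_pi hij⟩
  have hs : dist (A l) (A j) ∈ Ioo (Real.pi / 2) Real.pi :=
    ⟨hedge _ _ (Ne.symm hjl), hA.dist_lt_pi (Ne.symm hjl)⟩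
  have ht : dist (A k) (A j) ∈ Ioo (Real.pi / 2) Real.pi :=
    ⟨hedge _ _ (Ne.symm hjk), hA.dist_lt_pi (Ne.symm hjk)⟩
  have ha : sphAngle (A i) (A j) (A l) ∈ Ioo (Real.pi / 2) Real.pi :=
    ⟨hangle _ _ _ hij hjl hil, hA.sphAngle_lt_pi hn₁⟩
  have hβ : sphAngle (A l) (A j) (A k) ∈ Ioo (Real.pi / 2) Real.pi :=
    ⟨hangle _ _ _ (Ne.symm hjl) hjk (Ne.symm hkl), hA.sphAngle_lt_pi hn₂⟩
  have ha' : sphAngle (A k) (A j) (A i) ∈ Ioo (Real.pi / 2) Real.pi :=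
    ⟨hangle _ _ _ (Ne.symm hjk) (Ne.symm hij) (Ne.symm hik), hA.sphAngle_lt_pi hn₃⟩
  have hsum := hA.sphAngle_add_add_lt hn
  have hsin : ∀ {z : ℝ}, z ∈ Ioo (Real.pi / 2) Real.pi → 0 < Real.sin z := fun {z} hz =>
    Real.sin_pos_of_pos_of_lt_pi (by linarith [Real.pi_pos, hz.1]) hz.2
  have hcos : ∀ {x y : Sph 2} {x' y' : Sph 3}, dist x y = dist x' y' →
      inner ℝ x.vec y.vec = Real.cos (dist x' y') := fun {x y x' y'} h => by
    rw [← h, Sph.cos_dist]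
  have hlaw : ∀ {x y : Sph 2} {x' b y' : Sph 3}, dist x y = dist x' y' →
      inner ℝ x.vec y.vec = Real.cos (dist x' b) * Real.cos (dist y' b) +
        Real.sin (dist x' b) * Real.sin (dist y' b) * Real.cos (sphAngle x' b y') :=
    fun {x y x' b y'} h => by rw [← Sph.law_of_cosines, (Sph.dist_eq_iff _ _ _ _).1 h]
  obtain ⟨ν, hν₁, hν₂, hν₃, hν₄⟩ := h.outer k j l hn₄
  obtain ⟨ν', hν₁', hν₂', hν₃', hν₄'⟩ := h.outer l j k hn₅
  -- Here h is half the gap left around `B j` by the three face angles.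
  obtain ⟨e, f, ho, hc, hc', hy, hx⟩ := Ortho3.exists_frame (b := (B j).vec) (y := (B l).vec)
    (x := (B k).vec) (c := (C k).vec) (c' := (C l).vec)
    (h := (2 * Real.pi - sphAngle (A i) (A j) (A l) - sphAngle (A l) (A j) (A k) -
      sphAngle (A k) (A j) (A i)) / 2)
    (B j).inner_self (B l).inner_self (B k).inner_self (C k).inner_self (C l).inner_self
    (hsin hd) (hsin hs) (hsin ht) (hsin ha) (hsin hβ) (hsin ha')
    (hcos (h.base l j (Ne.symm hil) (Ne.symm hij))) (hcos (h.base k j (Ne.symm hik) (Ne.symm hij)))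
    (hcos (h.flap k j (Ne.symm hik) (Ne.symm hij) hjk))
    (hcos (h.flap l j (Ne.symm hil) (Ne.symm hij) hjl))
    (hlaw (h.base l k (Ne.symm hil) (Ne.symm hik)))
    (hlaw (h.flap k l (Ne.symm hik) (Ne.symm hil) (Ne.symm hkl)))
    (by rw [sphAngle_comm]; exact hlaw (h.flap l k (Ne.symm hil) (Ne.symm hik) hkl))
    hν₁ hν₂ hν₃ hν₄ hν₁' hν₂' hν₃' hν₄' (by ring)
  -- The polar angle h + a is above π/2 because a is and h > 0. It is below π because a < π is less
  -- than the sum of the other two face angles, both above π/2. The same holds for h + a'.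
  obtain ⟨O, E, h1⟩ := ho.exists_arc hd hs ht ⟨by linarith, by linarith [ha.1, hβ.1, ha'.1]⟩
    ⟨by linarith [hβ.2, ha'.2, ha.1], by linarith [hβ.1, ha'.1, ha.2]⟩
    ⟨by linarith [hβ.2, ha.2, ha'.1], by linarith [hβ.1, ha.1, ha'.2]⟩ hc hc' hy hx
  exact ⟨O, E, f, h1⟩

theorem exists_foldedArc (h : IsUnfolding A i B C) (hA : IsTetrahedron A)
    (hangle : ∀ i j k, i ≠ j → j ≠ k → i ≠ k → Real.pi / 2 < sphAngle (A i) (A j) (A k))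
    (hedge : ∀ i j, i ≠ j → Real.pi / 2 < dist (A i) (A j)) (hn : [i, j, k, l].Nodup) :
    ∃ (O : Sph 2) (σ : ℝ → Sph 2) (γ : ℝ → Sph 3),
      (∃ K t₁ t₂ L₁ L₂ L₃, FoldedArc A i j k l B C σ γ K t₁ t₂ L₁ L₂ L₃) ∧
      dist O (B j) < Real.pi / 2 ∧ Real.pi / 2 < dist O (B k) ∧ Real.pi / 2 < dist O (B l) ∧
      ∀ t, dist O (σ t) = Real.pi / 2 := by
  obtain ⟨O, E, f, ho, hOj, hOk, hOl, τ, hτ, hCk, hCl, ⟨τ₁, hτ₁, m, n, hm, hn₀, h₁⟩,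
    τ₂, hτ₂, m', n', hm', hn₀', h₂⟩ := h.exists_arc hA hangle hedge hn
  have hne := hn
  simp only [List.nodup_cons, List.mem_cons, List.not_mem_nil, or_false, not_or] at hne
  obtain ⟨⟨hij, hik, hil⟩, ⟨hjk, hjl⟩, hkl, -⟩ := hne
  obtain ⟨L₁, hL₁C, hL₁j, hL₁l⟩ := hA.exists_linearIsometry hij hil hjl
    (h.flap k j (Ne.symm hik) (Ne.symm hij) hjk)
    (h.flap k l (Ne.symm hik) (Ne.symm hil) (Ne.symm hkl))
    (h.base j l (Ne.symm hij) (Ne.symm hil))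
  obtain ⟨L₂, hL₂j, hL₂k, hL₂l⟩ := hA.exists_linearIsometry hjk hjl hkl
    (h.base j k (Ne.symm hij) (Ne.symm hik)) (h.base j l (Ne.symm hij) (Ne.symm hil))
    (h.base k l (Ne.symm hik) (Ne.symm hil))
  obtain ⟨L₃, hL₃C, hL₃j, hL₃k⟩ := hA.exists_linearIsometry hij hik hjk
    (h.flap l j (Ne.symm hil) (Ne.symm hij) hjl)
    (h.flap l k (Ne.symm hil) (Ne.symm hik) hkl)
    (h.base j k (Ne.symm hij) (Ne.symm hik))
  have hτ0 : 0 < τ := by linarith [Real.pi_pos, hτ.1]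
  obtain ⟨t₁, ht₁⟩ : ∃ t, τ * (1 - 2 * t) = τ₁ := ⟨(1 - τ₁ / τ) / 2, by field_simp; ring⟩
  obtain ⟨t₂, ht₂⟩ : ∃ t, τ * (1 - 2 * t) = -τ₂ := ⟨(1 + τ₂ / τ) / 2, by field_simp; ring⟩
  have ht₁0 : 0 < t₁ := by nlinarith [hτ₁.2, hτ.1]
  have ht₁₂ : t₁ < t₂ := by nlinarith [hτ₁.1, hτ₂.1]
  have ht₂1 : t₂ < 1 := by nlinarith [hτ₂.2, hτ.1]
  obtain ⟨σ, hσ, hσd, hσi, hσO⟩ := ho.exists_path hτ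
  have h₂' : Real.cos (-τ₂) • E + Real.sin (-τ₂) • f = m' • (B j).vec + n' • (B k).vec := by
    rw [← h₂, Real.cos_neg, Real.sin_neg]; module
  have hCl' : Real.cos (-τ) • E + Real.sin (-τ) • f = (C l).vec := by
    rw [hCl, Real.cos_neg, Real.sin_neg]; module
  have hσ₁ : (σ t₁).vec = m • (B j).vec + n • (B l).vec := by rw [hσ, ht₁, h₁]
  have hσ₂ : (σ t₂).vec = m' • (B j).vec + n' • (B k).vec := by rw [hσ, ht₂, h₂']
  obtain ⟨γ, hmap₁, hmap₂, hmap₃⟩ : ∃ γ : ℝ → Sph 3,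
      (∀ t ∈ Icc 0 t₁, L₁ (σ t).vec = (γ t).vec) ∧ (∀ t ∈ Icc t₁ t₂, L₂ (σ t).vec = (γ t).vec) ∧
      ∀ t ∈ Icc t₂ 1, L₃ (σ t).vec = (γ t).vec := by
    -- The definition is consistent at t₁ and t₂: there σ lies on the edges `B j`, `B l` and `B j`,
    -- `B k`, on which the adjacent foldings agree.
    refine ⟨fun t => if t ≤ t₁ then (σ t).map L₁ else if t ≤ t₂ then (σ t).map L₂ else
      (σ t).map L₃, fun t ht => ?_, fun t ht => ?_, fun t ht => ?_⟩
    · simp only [if_pos ht.2, Sph.map]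
    · rcases ht.1.eq_or_lt with rfl | h0
      · simp only [if_pos le_rfl, Sph.map, hσ₁, map_add, map_smul, hL₁j, hL₁l, hL₂j, hL₂l]
      · simp only [if_neg h0.not_ge, if_pos ht.2, Sph.map]
    · rcases ht.1.eq_or_lt with rfl | h0
      · simp only [if_neg ht₁₂.not_ge, if_pos le_rfl, Sph.map, hσ₂, map_add, map_smul, hL₂j, hL₂k,
          hL₃j, hL₃k]
      · simp only [if_neg h0.not_ge, if_neg (ht₁₂.trans h0).not_ge, Sph.map]
  let O' : Sph 2 := ⟨O, by
    rw [← sq_eq_sq₀ (norm_nonneg _) zero_le_one, ← real_inner_self_eq_norm_sq, ho.bb, one_pow]⟩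
  refine ⟨O', σ, γ, ⟨2 * τ, t₁, t₂, L₁, L₂, L₃, ?_⟩, (Sph.dist_lt_pi_div_two_iff _ _).2 hOj,
    (Sph.pi_div_two_lt_dist_iff _ _).2 hOk, (Sph.pi_div_two_lt_dist_iff _ _).2 hOl,
    fun t => (Sph.dist_eq_pi_div_two_iff _ _).2 (hσO t)⟩
  refine
    { nodup := hn
      K_pos := by linarith
      t₁_pos := ht₁0
      t₁_lt_t₂ := ht₁₂
      t₂_lt_one := ht₂1
      L₁_C := hL₁C
      L₃_C := hL₃C
      map₁ := hmap₁
      map₂ := hmap₂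
      map₃ := hmap₃
      dist_eq := hσd
      injOn := hσi
      start := ?_
      finish := ?_
      L₁_B := ?_
      L₂_B := ?_
      L₃_B := ?_
      weights := ?_ }
  · exact Sph.ext (by rw [hσ, hCk, mul_zero, sub_zero, mul_one])
  · exact Sph.ext (by rw [hσ, ← hCl', mul_one, show τ * (1 - 2) = -τ by ring])
  · intro a hai hak
    rcases Fin4.cases hn a with rfl | rfl | rfl | rfl
    exacts [absurd rfl hai, hL₁j, absurd rfl hak, hL₁l]
  · intro a hai
    rcases Fin4.cases hn a with rfl | rfl | rfl | rfl
    exacts [absurd rfl hai, hL₂j, hL₂k, hL₂l]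
  · intro a hai hal
    rcases Fin4.cases hn a with rfl | rfl | rfl | rfl
    exacts [absurd rfl hai, hL₃j, hL₃k, absurd rfl hal]
  · intro t ht
    obtain ⟨wi, wj, wk, wl, ⟨h0i, h0j, h0k, h0l⟩, hw, hcase⟩ := exists_arc_weights hτ hτ₁ hτ₂ hm hn₀
      hm' hn₀' hCk.symm hCl' h₁ h₂' ht₁ ht₂ ht₁₂ ht
    obtain ⟨w, rfl, rfl, rfl, rfl⟩ := Fin4.exists_eq hn wi wj wk wl
    refine ⟨w, fun p => ?_, ?_, hw⟩
    · rcases Fin4.cases hn p with rfl | rfl | rfl | rfl <;> assumption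
    rw [Fin4.sum_eq hn]
    rcases hcase with ⟨hc, heq⟩ | ⟨hc, heq⟩ | ⟨hc, heq⟩
    · rw [← hmap₁ t ⟨ht.1, hc⟩, hσ, heq, hw.1 hc]
      simp only [map_add, map_smul, hL₁C, hL₁j, hL₁l, zero_smul, add_zero]
    · rw [← hmap₂ t hc, hσ, heq, hw.2.1 hc.1 hc.2]
      simp only [map_add, map_smul, hL₂k, hL₂j, hL₂l, zero_smul, zero_add]
    · rw [← hmap₃ t ⟨hc, ht.2⟩, hσ, heq, hw.2.2.1 hc]
      simp only [map_add, map_smul, hL₃k, hL₃j, hL₃C, zero_smul, add_zero]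

end IsUnfolding

theorem FoldedArc.isGreatCircleArcAbout {A : Fin 4 → Sph 3} {i j k l : Fin 4}
    {B C : Fin 4 → Sph 2} {σ : ℝ → Sph 2} {γ : ℝ → Sph 3} {K t₁ t₂ : ℝ}
    {L₁ L₂ L₃ : EuclideanSpace ℝ (Fin 3) →ₗᵢ[ℝ] EuclideanSpace ℝ (Fin 4)}
    (h : FoldedArc A i j k l B C σ γ K t₁ t₂ L₁ L₂ L₃) {O : Sph 2}
    (hO : ∀ t, dist O (σ t) = Real.pi / 2) : IsGreatCircleArcAbout O σ := by
  refine ⟨(LipschitzWith.of_dist_le_mul (K := K.toNNReal) fun s u => ?_).continuous.continuousOn,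
    h.injOn, fun t _ => hO t⟩
  rw [Real.coe_toNNReal _ h.K_pos.le]
  exact h.dist_le s u

/-- The angle at b depends only on the inner products among the points, thus on the three side
lengths. It gives the equality of the angles at `B j`. -/
theorem sphAngle_eq_of_dist_eq {n : ℕ} {o b x y : Sph n} (h : dist x b = dist y b)
    (h' : dist o x = dist o y) : sphAngle o b x = sphAngle o b y := by
  have h1 := (Sph.dist_eq_iff _ _ _ _).1 h
  have h2 := (Sph.dist_eq_iff _ _ _ _).1 h'
  change InnerProductGeometry.angle (b.tangent o) (b.tangent x) =
    InnerProductGeometry.angle (b.tangent o) (b.tangent y)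
  rw [InnerProductGeometry.angle, InnerProductGeometry.angle, Sph.inner_tangent, Sph.inner_tangent,
    Sph.norm_tangent, Sph.norm_tangent, Sph.norm_tangent, h, h1, h2]

theorem theorem2 (A : Fin 4 → Sph 3) (hA : IsTetrahedron A)
    (hangle : ∀ i j k, i ≠ j → j ≠ k → i ≠ k → Real.pi / 2 < sphAngle (A i) (A j) (A k))
    (hedge : ∀ i j, i ≠ j → Real.pi / 2 < dist (A i) (A j)) :
    ∀ i : Fin 4, ∃ (γ : {j : Fin 4 // j ≠ i} → ℝ → Sph 3) (B C : Fin 4 → Sph 2),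
      (∀ j, IsSimpleGeodesicLoop A i (γ j)) ∧
      (∀ j j', j ≠ j' → γ j '' Icc 0 1 ≠ γ j' '' Icc 0 1) ∧
      IsUnfolding A i B C ∧
      ∀ j : {j : Fin 4 // j ≠ i}, ∃ (k l : Fin 4) (O : Sph 2) (σ : ℝ → Sph 2),
        [i, j.1, k, l].Nodup ∧
        dist O (B j.1) < Real.pi / 2 ∧
        dist O (C k) = Real.pi / 2 ∧ dist O (C l) = Real.pi / 2 ∧
        sphAngle O (B j.1) (C k) = sphAngle O (B j.1) (C l) ∧
        Real.pi / 2 < dist O (B k) ∧ Real.pi / 2 < dist O (B l) ∧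
        IsGreatCircleArcAbout O σ ∧ DevelopsTo A i k l B C (γ j) σ := by
  intro i
  obtain ⟨B, C, hBC⟩ := hA.exists_isUnfolding i
  have hkl : ∀ j : {j : Fin 4 // j ≠ i}, ∃ k l, [i, j.1, k, l].Nodup := by
    rintro ⟨j, hj⟩
    clear * - hj
    revert i j; decide
  choose k l hn using hkl
  choose O σ γ hγ hOj hOk hOl hOσ using fun j => hBC.exists_foldedArc hA hangle hedge (hn j)
  choose K t₁ t₂ L₁ L₂ L₃ hF using hγ
  refine ⟨γ, B, C, fun j => (hF j).isSimpleGeodesicLoop hA, fun j j' hjj' himg => ?_, hBC,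
    fun j => ?_⟩
  -- The loop of j has a point in the relative interior of the face opposite to j', which lies in no
  -- other face; the loop of j' is covered by the other faces.
  · obtain ⟨t, ht, w, hw, hpos⟩ := (hF j).exists_relint j'.2 fun h => hjj' (Subtype.ext h.symm)
    obtain ⟨s, hs, hst⟩ := himg ▸ mem_image_of_mem (γ j) ht
    obtain ⟨m, hm, hmem⟩ := (hF j').exists_mem_face hs
    rw [hst] at hmem
    exact hA.notMem_face hw (hpos m hm).ne' hmem
  · have hk := hOσ j 0
    have hl := hOσ j 1
    rw [(hF j).start] at hk
    rw [(hF j).finish] at hl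
    refine ⟨k j, l j, O j, σ j, hn j, hOj j, hk, hl,
      sphAngle_eq_of_dist_eq ?_ (hk.trans hl.symm), hOk j, hOl j,
      (hF j).isGreatCircleArcAbout (hOσ j), (hF j).developsTo⟩
    have hne := hn j
    simp only [List.nodup_cons, List.mem_cons, List.not_mem_nil, or_false, not_or] at hne
    rw [hBC.flap _ _ (Ne.symm hne.1.2.1) j.2 hne.2.1.1,
      hBC.flap _ _ (Ne.symm hne.1.2.2) j.2 hne.2.1.2]
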